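/- Let $f_k(x)$ be the Chebyshev polynomials of the second kind in the normalisation $f_0=1$, $f_1=x$, $f_{k+2}=xf_{k+1}-f_k$ (equivalently, $f_k(2\cos\theta)=\sin((k+1)\theta)/\sin\theta$). Graphs are finite and undirected, with multiple edges and loops allowed; the $(i,j)$ entry of the adjacency matrix is the number of edges between the vertices $i$ and $j$ (so a loop at $i$ contributes $1$ to the entry $(i,i)$), and adjacency matrices are considered up to simultaneous permutation of rows and columns. A nonempty square matrix is called indecomposable if no simultaneous permutation of its rows and columns makes it block diagonal with at least two nonempty diagonal blocks. A sequence of matrices $(M_k)_{k\ge0}$ of a fixed size grows linearly if $\|M_k\|=\Theta(k)$ as $k\to\infty$, for one (equivalently any) norm. Consider the following diagrams. - $A_n$ ($n\ge1$): the path with $n$ vertices. - $D_n$ ($n\ge4$): the path $3 - 4 - \cdots - n$ together with two vertices $1,2$ joined to $3$. - $E_n$ ($n=6,7,8$): the path $1 - 2 - \cdots - (n-1)$ together with a vertex $n$ joined to $3$. - $L_n$ ($n\ge1$): the path with $n$ vertices with one loop at one end vertex. - $\widetilde A_n$ ($n\ge1$): the cycle with $n+1$ vertices (for $n=1$: two vertices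 joined by two edges). - $\widetilde D_n$ ($n\ge4$): the path $3 - \cdots - (n-1)$ together with two vertices $1,2$ joined to $3$ and two vertices $n,n+1$ joined to $n-1$. - $\widetilde E_6,\widetilde E_7,\widetilde E_8$: the trees consisting of one central vertex and three arms (paths attached to it) with $(2,2,2)$, $(3,3,1)$, $(5,2,1)$ vertices, respectively. - $\widetilde L_n$ ($n\ge1$): the path with $n$ vertices with a loop at each end (for $n=1$: one vertex with two loops). - $\widetilde{DL}_n$ ($n\ge3$): the path $3 - \cdots - n$ together with two vertices $1,2$ joined to $3$, and with a loop at $n$. **Theorem.** Let $X$ be an indecomposable symmetric matrix with nonnegative integer entries. (a) $f_d(X)=0$ for some $d\ge1$ if and only if $X$ is the adjacency matrix of a diagram of type $A$, $D$, $E$ or $L$. (b) The sequence $(f_k(X))_{k\ge0}$ grows linearly if and only if $X$ is the adjacency matrix of a diagram of type $\widetilde A$, $\widetilde D$, $\widetilde E$, $\widetilde L$ or $\widetilde{DL}$. -/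

import Mathlib

open scoped Asymptotics

namespace ChebyshevDynkin

/-- A finite undirected graph, multiple edges and loops allowed: its vertices are labelled
`1, …, size`, and `edges` is the multiset of its edges (a loop at `a` is the pair `s(a, a)`). -/
structure Diagram where
  size : ℕ
  edges : Multiset (Sym2 ℕ)

/-- The adjacency matrix of a diagram: its entry for the vertices `a`, `b` is the number of edges
between `a` and `b`. The row with index `i : Fin size` belongs to the vertex `i + 1`. -/
def Diagram.adjMatrix (G : Diagram) : Matrix (Fin G.size) (Fin G.size) ℤ :=
  fun i j => (G.edges.count s((i : ℕ) + 1, (j : ℕ) + 1) : ℤ)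

/-- `X` is the adjacency matrix of `G`, up to the labelling of the vertices. -/
def IsAdjMatrixOf {ι : Type*} (X : Matrix ι ι ℤ) (G : Diagram) : Prop :=
  ∃ e : ι ≃ Fin G.size, X = G.adjMatrix.submatrix e e

/-- The edges `a — (a+1) — ⋯ — b` of a path (no edge if `b ≤ a`). -/
def path (a b : ℕ) : Multiset (Sym2 ℕ) :=
  (Multiset.Ico a b).map fun i => s(i, i + 1)

/-- `Aₙ`: the path with `n` vertices. -/
def typeA (n : ℕ) : Diagram := ⟨n, path 1 n⟩

/-- `Dₙ`: the path `3 — ⋯ — n` with two further vertices `1`, `2` joined to `3`. -/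
def typeD (n : ℕ) : Diagram := ⟨n, {s(1, 3), s(2, 3)} + path 3 n⟩

/-- `Eₙ` (for `n = 6, 7, 8`): the path `1 — ⋯ — (n-1)` with a further vertex `n` joined to `3`. -/
def typeE (n : ℕ) : Diagram := ⟨n, path 1 (n - 1) + {s(3, n)}⟩

/-- `Lₙ`: the path with `n` vertices and a loop at one end. -/
def typeL (n : ℕ) : Diagram := ⟨n, {s(1, 1)} + path 1 n⟩

/-- `Ãₙ`: the cycle with `n + 1` vertices (two vertices joined by a double edge if `n = 1`). -/
def typeTildeA (n : ℕ) : Diagram := ⟨n + 1, path 1 (n + 1) + {s(n + 1, 1)}⟩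

/-- `D̃ₙ`: the path `3 — ⋯ — (n-1)` with two further vertices `1`, `2` joined to `3` and two
further vertices `n`, `n + 1` joined to `n - 1`. -/
def typeTildeD (n : ℕ) : Diagram :=
  ⟨n + 1, {s(1, 3), s(2, 3)} + path 3 (n - 1) + {s(n - 1, n), s(n - 1, n + 1)}⟩

/-- `Ẽ₆`: three arms with two vertices each at the vertex `3`. -/
def typeTildeE6 : Diagram := ⟨7, path 1 5 + {s(3, 6), s(6, 7)}⟩

/-- `Ẽ₇`: arms with three, three and one vertices at the vertex `3`. -/
def typeTildeE7 : Diagram := ⟨8, path 1 6 + {s(8, 1), s(3, 7)}⟩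

/-- `Ẽ₈`: arms with two, five and one vertices at the vertex `3`. -/
def typeTildeE8 : Diagram := ⟨9, path 1 7 + {s(7, 9), s(3, 8)}⟩

/-- `L̃ₙ`: the path with `n` vertices and a loop at each end (one vertex with two loops if
`n = 1`). -/
def typeTildeL (n : ℕ) : Diagram := ⟨n, {s(1, 1)} + path 1 n + {s(n, n)}⟩

/-- `D̃Lₙ`: the path `3 — ⋯ — n` with two further vertices `1`, `2` joined to `3` and a loop at
`n`. -/
def typeTildeDL (n : ℕ) : Diagram := ⟨n, {s(1, 3), s(2, 3)} + path 3 n + {s(n, n)}⟩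

/-- The diagrams of type `A`, `D`, `E` or `L`. -/
def IsTypeADEL (G : Diagram) : Prop :=
  (∃ n : ℕ, 1 ≤ n ∧ G = typeA n) ∨
  (∃ n : ℕ, 4 ≤ n ∧ G = typeD n) ∨
  (G = typeE 6 ∨ G = typeE 7 ∨ G = typeE 8) ∨
  (∃ n : ℕ, 1 ≤ n ∧ G = typeL n)

/-- The diagrams of type `Ã`, `D̃`, `Ẽ`, `L̃` or `D̃L`. -/
def IsTypeTilde (G : Diagram) : Prop :=
  (∃ n : ℕ, 1 ≤ n ∧ G = typeTildeA n) ∨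
  (∃ n : ℕ, 4 ≤ n ∧ G = typeTildeD n) ∨
  (G = typeTildeE6 ∨ G = typeTildeE7 ∨ G = typeTildeE8) ∨
  (∃ n : ℕ, 1 ≤ n ∧ G = typeTildeL n) ∨
  (∃ n : ℕ, 3 ≤ n ∧ G = typeTildeDL n)

/-- A square matrix is indecomposable if it is nonempty and no simultaneous permutation of its
rows and columns makes it block diagonal with at least two (nonempty) diagonal blocks. -/
def IsIndecomposable {ι : Type*} (X : Matrix ι ι ℤ) : Prop :=
  Nonempty ι ∧ ∀ s : Set ι, s.Nonempty → sᶜ.Nonempty →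
    ∃ i ∈ s, ∃ j ∈ sᶜ, X i j ≠ 0 ∨ X j i ≠ 0

/-- `f k X`, where `f k` is the (rescaled) Chebyshev polynomial of the second kind given by
`f 0 = 1`, `f 1 = x`, `f (k + 2) = x * f (k + 1) - f k`. -/
noncomputable def f {ι : Type*} [Fintype ι] [DecidableEq ι] (k : ℕ) (X : Matrix ι ι ℤ) :
    Matrix ι ι ℤ :=
  Polynomial.aeval X (Polynomial.Chebyshev.S ℤ (k : ℤ))

/-- A sequence of matrices grows linearly if the norm of its `k`-th term is of exact order `k` as
`k → ∞`. The norm used is the sum of the absolute values of the entries; as all norms on real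
matrices of a given size are equivalent, the choice does not matter. -/
def GrowsLinearly {ι : Type*} [Fintype ι] (M : ℕ → Matrix ι ι ℤ) : Prop :=
  (fun k : ℕ => ∑ i, ∑ j, |(M k i j : ℝ)|) =Θ[Filter.atTop] (fun k : ℕ => (k : ℝ))

end ChebyshevDynkin

/-!
Write `q(v) = 2 v·v - v·Xv`. Everything is governed by the sign of `q`, and the sign of `q` by
positive integer vectors `δ` with `X δ ≤ 2 δ`.

*Diagrams of type `A`, `D`, `E`, `L`.* Each carries a positive `δ` with `X δ ≤ 2 δ`, strictly at
some vertex. The recursion `u (k + 2) = X u (k + 1) - u k` preserves the quadratic form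
`u (k + 1)·u (k + 1) - u k·X u (k + 1) + u k·u k`, which is a combination of `2 - X` and `2 + X`
(`energy_const`). Both are sums of squares in terms of `δ` (`sum_of_squares`), so `f k X` is bounded
(`bounded_of_recursion`). Hence it does not grow linearly, and since its entries are integers the
recursion is periodic; as it can be run backwards and `f (-1) = 0`, some later `f d X` vanishes
(`exists_f_eq_zero_of_bounded`).

*Extended diagrams.* Each carries a positive `δ` with `X δ = 2 δ`. Then `f k X δ = (k + 1) δ`, which
gives a linear lower bound and excludes `f d X = 0`. By the Schur test `X` has norm at most `2`, and
the invariant form gives the linear upper bound (`growsLinearly_of_harmonic`).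

*All other matrices.* If `f d X = 0` or `f k X` grows linearly, then `q` is nonnegative, because an
eigenvalue greater than `2` would make `f k X` grow faster than linearly without vanishing
(`exists_growing_eigenvector`). If `q` is nonnegative and an extended diagram is contained in `X`,
then `X` is this diagram (`isAdjMatrixOf_of_embedding`): its `δ`, extended by zero, satisfies
`2 δ ≤ X δ`, nonnegativity of `q` makes this an equality, and indecomposability gives `δ` full
support. So suppose that `X` contains no extended diagram (`IsFiniteType`). Excluding `Ã`, `D̃`, `L̃`
and `D̃L` shows that there are no cycles and no multiple edges, and at most one loop or vertex of
degree at least three, never both; so `X` consists of at most three arms issuing from one vertex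
(`exists_spanning_spider`). Excluding `Ẽ₆`, `Ẽ₇`, `Ẽ₈` bounds the lengths of the arms
(`IsFiniteType.exists_isTypeADEL`).
-/

namespace ChebyshevDynkin

open Matrix Finset

/-! ### The recursion and its invariant form -/

section Recursion

variable {ι : Type*} [Fintype ι] [DecidableEq ι]

lemma f_zero (X : Matrix ι ι ℤ) : f 0 X = 1 := by simp [f]

lemma f_one (X : Matrix ι ι ℤ) : f 1 X = X := by simp [f]

lemma f_add_two (X : Matrix ι ι ℤ) (k : ℕ) : f (k + 2) X = X * f (k + 1) X - f k X := by
  simp [f, Polynomial.Chebyshev.S_add_two]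

/-- The columns of `f k X`, read as real vectors, satisfy the Chebyshev recursion. -/
lemma f_col_recursion (X : Matrix ι ι ℤ) (j : ι) (k : ℕ) :
    (fun i => (f (k + 2) X i j : ℝ)) =
      X.map (Int.cast : ℤ → ℝ) *ᵥ (fun i => (f (k + 1) X i j : ℝ)) - fun i => (f k X i j : ℝ) := by
  ext i
  simp [f_add_two, Matrix.mul_apply, Matrix.mulVec, dotProduct]

end Recursion

lemma isSymm_map_cast {ι : Type*} {X : Matrix ι ι ℤ} (hX : X.IsSymm) :
    (X.map (Int.cast : ℤ → ℝ)).IsSymm := by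
  ext i j
  simp [hX.apply i j]

section Forms

variable {ι : Type*} [Fintype ι] {Y : Matrix ι ι ℝ}

/-- The invariant quadratic form of the recursion `u (k + 2) = Y u (k + 1) - u k`. -/
lemma energy_const (hY : Y.IsSymm) {u : ℕ → ι → ℝ}
    (hu : ∀ k, u (k + 2) = Y *ᵥ u (k + 1) - u k) (k : ℕ) :
    u (k + 1) ⬝ᵥ u (k + 1) - u k ⬝ᵥ Y *ᵥ u (k + 1) + u k ⬝ᵥ u k =
      u 1 ⬝ᵥ u 1 - u 0 ⬝ᵥ Y *ᵥ u 1 + u 0 ⬝ᵥ u 0 := by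
  induction k with
  | zero => rfl
  | succ k ih =>
    rw [← ih]
    have h1 : u (k + 1) ⬝ᵥ Y *ᵥ u (k + 2) = u (k + 2) ⬝ᵥ Y *ᵥ u (k + 1) := by
      rw [dotProduct_mulVec, ← mulVec_transpose, hY.eq, dotProduct_comm]
    have h2 : Y *ᵥ u (k + 1) = u (k + 2) + u k := by rw [hu k]; abel
    rw [show k + 1 + 1 = k + 2 from rfl, h1, h2]
    simp only [dotProduct_add]
    rw [dotProduct_comm (u (k + 2)) (u k)]
    ring

/-- A sum-of-squares formula for `2 ± Y` in terms of a positive vector `δ`; `ε = ±1` is the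
sign. -/
lemma sum_of_squares (hY : Y.IsSymm) {δ : ι → ℝ} (hδ : ∀ i, 0 < δ i) {ε : ℝ} (hε : ε ^ 2 = 1)
    (v : ι → ℝ) :
    2 * (v ⬝ᵥ v) - ε * (v ⬝ᵥ Y *ᵥ v) =
      ∑ i, (2 * δ i - (Y *ᵥ δ) i) / δ i * v i ^ 2 +
        (∑ i, ∑ j, Y i j * δ i * δ j * (v i / δ i - ε * (v j / δ j)) ^ 2) / 2 := by
  have h1 : ∀ i j, Y i j * δ i * δ j * (v i / δ i - ε * (v j / δ j)) ^ 2 =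
      Y i j * δ j * (v i ^ 2 / δ i) + Y i j * δ i * (v j ^ 2 / δ j) -
        2 * ε * (v i * (Y i j * v j)) := by
    intro i j
    have := (hδ i).ne'
    have := (hδ j).ne'
    field_simp
    linear_combination (Y i j * δ i ^ 2 * v j ^ 2) * hε
  have h2 : ∑ i, ∑ j, Y i j * δ j * (v i ^ 2 / δ i) = ∑ i, (Y *ᵥ δ) i * (v i ^ 2 / δ i) := by
    simp only [mulVec, dotProduct, sum_mul]
  have h3 : ∑ i, ∑ j, Y i j * δ i * (v j ^ 2 / δ j) = ∑ i, (Y *ᵥ δ) i * (v i ^ 2 / δ i) := by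
    rw [sum_comm, ← h2]
    refine sum_congr rfl fun i _ => sum_congr rfl fun j _ => ?_
    rw [hY.apply i j]
  have h4 : ∑ i, ∑ j, 2 * ε * (v i * (Y i j * v j)) = 2 * ε * (v ⬝ᵥ Y *ᵥ v) := by
    simp only [mulVec, dotProduct, mul_sum]
  have h5 : ∑ i, (2 * δ i - (Y *ᵥ δ) i) / δ i * v i ^ 2 =
      2 * (v ⬝ᵥ v) - ∑ i, (Y *ᵥ δ) i * (v i ^ 2 / δ i) := by
    simp only [dotProduct, mul_sum, ← sum_sub_distrib]
    refine sum_congr rfl fun i _ => ?_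
    have := (hδ i).ne'
    field_simp
  simp only [h1, sum_add_distrib, sum_sub_distrib, h2, h3, h4, h5]
  ring

lemma form_nonneg (hY : Y.IsSymm) (hY0 : ∀ i j, 0 ≤ Y i j) {δ : ι → ℝ} (hδ : ∀ i, 0 < δ i)
    (hle : ∀ i, (Y *ᵥ δ) i ≤ 2 * δ i) {ε : ℝ} (hε : ε ^ 2 = 1) (v : ι → ℝ) :
    0 ≤ 2 * (v ⬝ᵥ v) - ε * (v ⬝ᵥ Y *ᵥ v) := by
  rw [sum_of_squares hY hδ hε]
  refine add_nonneg (sum_nonneg fun i _ => mul_nonneg (div_nonneg ?_ (hδ i).le) (sq_nonneg _))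
    (div_nonneg (sum_nonneg fun i _ => sum_nonneg fun j _ => ?_) zero_le_two)
  · linarith [hle i]
  · exact mul_nonneg (mul_nonneg (mul_nonneg (hY0 i j) (hδ i).le) (hδ j).le) (sq_nonneg _)

/-- If `Y` is connected and `Y δ ≤ 2 δ` for a positive `δ`, with strict inequality somewhere, then
every family of vectors on which the form `2 ± Y` is bounded is bounded in each coordinate:
at the strict place by the diagonal part of the sum of squares, and then along the edges. -/
lemma bounded_of_form_bounded (hY : Y.IsSymm) (hY0 : ∀ i j, 0 ≤ Y i j) {δ : ι → ℝ}
    (hδ : ∀ i, 0 < δ i) (hle : ∀ i, (Y *ᵥ δ) i ≤ 2 * δ i) {i₀ : ι}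
    (hlt : (Y *ᵥ δ) i₀ < 2 * δ i₀)
    (hconn : ∀ s : Set ι, s.Nonempty → sᶜ.Nonempty → ∃ i ∈ s, ∃ j ∈ sᶜ, 0 < Y i j)
    {ε : ℝ} (hε : ε ^ 2 = 1) {κ : Type*} {v : κ → ι → ℝ} {B : ℝ}
    (hB : ∀ k, 2 * (v k ⬝ᵥ v k) - ε * (v k ⬝ᵥ Y *ᵥ v k) ≤ B) (i : ι) :
    ∃ C, ∀ k, (v k i / δ i) ^ 2 ≤ C := by
  have hdiag : ∀ k i, 0 ≤ (2 * δ i - (Y *ᵥ δ) i) / δ i * v k i ^ 2 := fun k i =>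
    mul_nonneg (div_nonneg (by linarith [hle i]) (hδ i).le) (sq_nonneg _)
  have hedge : ∀ k i j, 0 ≤ Y i j * δ i * δ j * (v k i / δ i - ε * (v k j / δ j)) ^ 2 :=
    fun k i j => mul_nonneg (mul_nonneg (mul_nonneg (hY0 i j) (hδ i).le) (hδ j).le) (sq_nonneg _)
  have hdiagB : ∀ k i, (2 * δ i - (Y *ᵥ δ) i) / δ i * v k i ^ 2 ≤ B := by
    intro k i
    have h1 := single_le_sum (f := fun i => (2 * δ i - (Y *ᵥ δ) i) / δ i * v k i ^ 2)
      (fun i _ => hdiag k i) (mem_univ i)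
    have h2 : 0 ≤ ∑ i, ∑ j, Y i j * δ i * δ j * (v k i / δ i - ε * (v k j / δ j)) ^ 2 :=
      sum_nonneg fun i _ => sum_nonneg fun j _ => hedge k i j
    have h3 := hB k
    rw [sum_of_squares hY hδ hε] at h3
    linarith
  have hedgeB : ∀ k i j, Y i j * δ i * δ j * (v k i / δ i - ε * (v k j / δ j)) ^ 2 ≤ 2 * B := by
    intro k i j
    have h0 := single_le_sum
      (f := fun j => Y i j * δ i * δ j * (v k i / δ i - ε * (v k j / δ j)) ^ 2)
      (fun j _ => hedge k i j) (mem_univ j)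
    have h1 := single_le_sum
      (f := fun i => ∑ j, Y i j * δ i * δ j * (v k i / δ i - ε * (v k j / δ j)) ^ 2)
      (fun i _ => sum_nonneg fun j _ => hedge k i j) (mem_univ i)
    have h2 : 0 ≤ ∑ i, (2 * δ i - (Y *ᵥ δ) i) / δ i * v k i ^ 2 :=
      sum_nonneg fun i _ => hdiag k i
    have h3 := hB k
    rw [sum_of_squares hY hδ hε] at h3
    linarith
  by_contra hi
  obtain ⟨a, ⟨C, hC⟩, b, hb, hab⟩ :=
    hconn {i | ∃ C, ∀ k, (v k i / δ i) ^ 2 ≤ C} ⟨i₀, by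
      have hpos : 0 < (2 * δ i₀ - (Y *ᵥ δ) i₀) / δ i₀ := div_pos (by linarith) (hδ i₀)
      refine ⟨B / ((2 * δ i₀ - (Y *ᵥ δ) i₀) / δ i₀) / δ i₀ ^ 2, fun k => ?_⟩
      rw [div_pow]
      gcongr
      rw [le_div_iff₀ hpos, mul_comm]
      exact hdiagB k i₀⟩ ⟨i, hi⟩
  refine hb ⟨2 * (2 * B / (Y a b * δ a * δ b)) + 2 * C, fun k => ?_⟩
  have hpos : 0 < Y a b * δ a * δ b := mul_pos (mul_pos hab (hδ a)) (hδ b)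
  have h1 : (v k a / δ a - ε * (v k b / δ b)) ^ 2 ≤ 2 * B / (Y a b * δ a * δ b) := by
    rw [le_div_iff₀ hpos, mul_comm]
    exact hedgeB k a b
  have h2 : (v k b / δ b) ^ 2 = (ε * (v k b / δ b)) ^ 2 := by rw [mul_pow, hε, one_mul]
  rw [h2]
  nlinarith [hC k, sq_nonneg (2 * (v k a / δ a) - ε * (v k b / δ b))]

/-- Under the hypotheses of `bounded_of_form_bounded`, every solution of the recursion is
bounded: the invariant form is a combination of `2 - Y` at `u (k + 1) + u k` and `2 + Y` at
`u (k + 1) - u k`. -/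
lemma bounded_of_recursion (hY : Y.IsSymm) (hY0 : ∀ i j, 0 ≤ Y i j) {δ : ι → ℝ}
    (hδ : ∀ i, 0 < δ i) (hle : ∀ i, (Y *ᵥ δ) i ≤ 2 * δ i) {i₀ : ι}
    (hlt : (Y *ᵥ δ) i₀ < 2 * δ i₀)
    (hconn : ∀ s : Set ι, s.Nonempty → sᶜ.Nonempty → ∃ i ∈ s, ∃ j ∈ sᶜ, 0 < Y i j)
    {u : ℕ → ι → ℝ} (hu : ∀ k, u (k + 2) = Y *ᵥ u (k + 1) - u k) (i : ι) :
    ∃ C, ∀ k, |u k i| ≤ C := by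
  set E := u 1 ⬝ᵥ u 1 - u 0 ⬝ᵥ Y *ᵥ u 1 + u 0 ⬝ᵥ u 0 with hE
  have hsplit : ∀ k, (2 * ((u (k + 1) + u k) ⬝ᵥ (u (k + 1) + u k)) -
        1 * ((u (k + 1) + u k) ⬝ᵥ Y *ᵥ (u (k + 1) + u k))) +
      (2 * ((u (k + 1) - u k) ⬝ᵥ (u (k + 1) - u k)) -
        (-1) * ((u (k + 1) - u k) ⬝ᵥ Y *ᵥ (u (k + 1) - u k))) = 4 * E := by
    intro k
    rw [hE, ← energy_const hY hu k]
    have h1 : u (k + 1) ⬝ᵥ Y *ᵥ u k = u k ⬝ᵥ Y *ᵥ u (k + 1) := by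
      rw [dotProduct_mulVec, ← mulVec_transpose, hY.eq, dotProduct_comm]
    simp only [mulVec_add, mulVec_sub, dotProduct_add, dotProduct_sub, add_dotProduct,
      sub_dotProduct, h1, dotProduct_comm (u (k + 1)) (u k)]
    ring
  obtain ⟨C₁, h₁⟩ := bounded_of_form_bounded hY hY0 hδ hle hlt hconn (ε := 1) (by norm_num)
    (v := fun k => u (k + 1) + u k) (B := 4 * E) (fun k => by
      have := form_nonneg hY hY0 hδ hle (ε := -1) (by norm_num) (u (k + 1) - u k)
      have := hsplit k
      linarith) i
  obtain ⟨C₂, h₂⟩ := bounded_of_form_bounded hY hY0 hδ hle hlt hconn (ε := -1) (by norm_num)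
    (v := fun k => u (k + 1) - u k) (B := 4 * E) (fun k => by
      have := form_nonneg hY hY0 hδ hle (ε := 1) (by norm_num) (u (k + 1) + u k)
      have := hsplit k
      linarith) i
  refine ⟨δ i * (1 + C₁ + C₂), fun k => ?_⟩
  have e1 := h₁ k
  have e2 := h₂ k
  simp only [Pi.add_apply, Pi.sub_apply, add_div, sub_div] at e1 e2
  have hd := hδ i
  have h3 : |u k i| = δ i * |u k i / δ i| := by
    rw [abs_div, abs_of_pos hd]; field_simp
  rw [h3]
  refine mul_le_mul_of_nonneg_left ?_ hd.le
  rw [abs_le]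
  constructor <;>
    nlinarith [sq_nonneg (u (k + 1) i / δ i), sq_nonneg (u k i / δ i - 1),
      sq_nonneg (u k i / δ i + 1)]

/-- The Schur test: a symmetric nonnegative matrix with `Y δ ≤ 2 δ` for a positive vector `δ` has
operator norm at most `2`. -/
lemma schur_test (hY : Y.IsSymm) (hY0 : ∀ i j, 0 ≤ Y i j) {δ : ι → ℝ}
    (hδ : ∀ i, 0 < δ i) (hle : ∀ i, (Y *ᵥ δ) i ≤ 2 * δ i) (v : ι → ℝ) :
    Y *ᵥ v ⬝ᵥ Y *ᵥ v ≤ 4 * (v ⬝ᵥ v) := by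
  have h1 : ∀ i, (Y *ᵥ v) i * (Y *ᵥ v) i ≤ 2 * δ i * ∑ j, Y i j * (v j ^ 2 / δ j) := by
    intro i
    have hn : ∀ j, 0 ≤ Y i j * (v j ^ 2 / δ j) := fun j =>
      mul_nonneg (hY0 i j) (div_nonneg (sq_nonneg _) (hδ j).le)
    have hcs := sum_sq_le_sum_mul_sum_of_sq_le_mul univ (r := fun j => Y i j * v j)
      (f := fun j => Y i j * δ j) (g := fun j => Y i j * (v j ^ 2 / δ j))
      (fun j _ => mul_nonneg (hY0 i j) (hδ j).le) (fun j _ => hn j) (fun j _ => by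
        have := (hδ j).ne'
        apply le_of_eq
        field_simp)
    rw [← sq]
    exact hcs.trans (mul_le_mul_of_nonneg_right (hle i) (sum_nonneg fun j _ => hn j))
  calc Y *ᵥ v ⬝ᵥ Y *ᵥ v ≤ ∑ i, 2 * δ i * ∑ j, Y i j * (v j ^ 2 / δ j) :=
        sum_le_sum fun i _ => h1 i
    _ = ∑ j, 2 * (Y *ᵥ δ) j * (v j ^ 2 / δ j) := by
        simp only [mulVec, dotProduct, mul_sum, sum_mul]
        rw [sum_comm]
        refine sum_congr rfl fun j _ => sum_congr rfl fun i _ => ?_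
        rw [hY.apply i j]
        ring
    _ ≤ ∑ j, 2 * (2 * δ j) * (v j ^ 2 / δ j) := by
        refine sum_le_sum fun j _ => mul_le_mul_of_nonneg_right ?_
          (div_nonneg (sq_nonneg _) (hδ j).le)
        linarith [hle j]
    _ = 4 * (v ⬝ᵥ v) := by
        simp only [dotProduct, mul_sum]
        refine sum_congr rfl fun j _ => ?_
        have := (hδ j).ne'
        field_simp
        ring

/-- If `Y` has operator norm at most `2`, solutions of the recursion grow at most linearly. -/
lemma linear_bound_of_recursion (hY : Y.IsSymm)
    (hnorm : ∀ v : ι → ℝ, Y *ᵥ v ⬝ᵥ Y *ᵥ v ≤ 4 * (v ⬝ᵥ v))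
    {u : ℕ → ι → ℝ} (hu : ∀ k, u (k + 2) = Y *ᵥ u (k + 1) - u k) :
    ∃ C, ∀ k i, |u k i| ≤ C * (k + 1) := by
  set E := u 1 ⬝ᵥ u 1 - u 0 ⬝ᵥ Y *ᵥ u 1 + u 0 ⬝ᵥ u 0 with hE
  have hsq : ∀ v : ι → ℝ, ‖WithLp.toLp 2 v‖ ^ 2 = v ⬝ᵥ v := by
    intro v
    rw [EuclideanSpace.real_norm_sq_eq]
    simp [dotProduct, sq]
  have hstep : ∀ k, ‖WithLp.toLp 2 (u (k + 1))‖ ≤ ‖WithLp.toLp 2 (u k)‖ + √E := by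
    intro k
    have h1 : ‖WithLp.toLp 2 (u (k + 1) - (1 / 2 : ℝ) • Y *ᵥ u k)‖ ≤ √E := by
      refine Real.le_sqrt_of_sq_le ?_
      rw [hsq, hE, ← energy_const hY hu k]
      have h := hnorm (u k)
      have h2 : u k ⬝ᵥ Y *ᵥ u (k + 1) = u (k + 1) ⬝ᵥ Y *ᵥ u k := by
        rw [dotProduct_mulVec, ← mulVec_transpose, hY.eq, dotProduct_comm]
      simp only [dotProduct_sub, sub_dotProduct, dotProduct_smul, smul_dotProduct, smul_eq_mul, h2,
        dotProduct_comm (Y *ᵥ u k) (u (k + 1))]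
      linarith
    have h2 : ‖WithLp.toLp 2 ((1 / 2 : ℝ) • Y *ᵥ u k)‖ ≤ ‖WithLp.toLp 2 (u k)‖ := by
      refine le_of_sq_le_sq ?_ (norm_nonneg _)
      rw [hsq, hsq]
      have h := hnorm (u k)
      simp only [dotProduct_smul, smul_dotProduct, smul_eq_mul]
      linarith
    have h3 : WithLp.toLp 2 (u (k + 1)) = WithLp.toLp 2 (u (k + 1) - (1 / 2 : ℝ) • Y *ᵥ u k) +
        WithLp.toLp 2 ((1 / 2 : ℝ) • Y *ᵥ u k) := by
      rw [← WithLp.toLp_add, sub_add_cancel]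
    rw [h3]
    exact (norm_add_le _ _).trans (by linarith)
  have hk : ∀ k : ℕ, ‖WithLp.toLp 2 (u k)‖ ≤ ‖WithLp.toLp 2 (u 0)‖ + k * √E := by
    intro k
    induction k with
    | zero => simp
    | succ k ih => push_cast; linarith [hstep k]
  refine ⟨‖WithLp.toLp 2 (u 0)‖ + √E, fun k i => ?_⟩
  have h1 : |u k i| ≤ ‖WithLp.toLp 2 (u k)‖ := by
    simpa using PiLp.norm_apply_le (WithLp.toLp 2 (u k)) i
  have h2 := hk k
  have h3 := norm_nonneg (WithLp.toLp 2 (u 0))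
  have h4 := Real.sqrt_nonneg E
  have h5 : (0 : ℝ) ≤ k := by positivity
  nlinarith [mul_nonneg h3 h5]

end Forms

/-! ### Boundedness, linear growth and faster growth -/

section Growth

variable {ι : Type*} [Fintype ι] [DecidableEq ι]

/-- If the integer matrices `f k X` are bounded, two pairs `(f k X, f (k + 1) X)` agree; running the
recursion backwards from there gives a zero of the sequence. -/
lemma exists_f_eq_zero_of_bounded [Nonempty ι] {X : Matrix ι ι ℤ}
    (hb : ∀ i j, ∃ C, ∀ k, |(f k X i j : ℝ)| ≤ C) : ∃ d : ℕ, 1 ≤ d ∧ f d X = 0 := by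
  choose C hC using hb
  let N : ι → ι → ℤ := fun i j => ⌈C i j⌉
  have hmem : ∀ k, (f k X : ι → ι → ℤ) ∈ Set.Icc (-N) N := by
    intro k
    have h : ∀ i j, |f k X i j| ≤ N i j := fun i j => by
      have := (hC i j k).trans (Int.le_ceil _)
      exact_mod_cast this
    exact ⟨fun i j => (abs_le.mp (h i j)).1, fun i j => (abs_le.mp (h i j)).2⟩
  have hfin : (Set.Icc (-N) N ×ˢ Set.Icc (-N) N).Finite :=
    (Set.finite_Icc _ _).prod (Set.finite_Icc _ _)
  obtain ⟨a, b, hab, h⟩ := hfin.exists_lt_map_eq_of_forall_mem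
    (f := fun k : ℕ => ((f k X : ι → ι → ℤ), (f (k + 1) X : ι → ι → ℤ)))
    (fun k => Set.mk_mem_prod (hmem k) (hmem (k + 1)))
  obtain ⟨h0, h1⟩ := Prod.mk.inj h
  obtain ⟨m, hm, rfl⟩ : ∃ m, 1 ≤ m ∧ b = a + m := ⟨b - a, by omega, by omega⟩
  have hback : ∀ a : ℕ, f a X = f (a + m) X → f (a + 1) X = f (a + m + 1) X →
      f 0 X = f m X ∧ f 1 X = f (m + 1) X := by
    intro a
    induction a with
    | zero => intro h0 h1; simpa using And.intro h0 h1
    | succ a ih =>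
      intro h0 h1
      have e1 := f_add_two X a
      have e2 := f_add_two X (a + m)
      rw [show a + 1 + m = a + m + 1 by ring] at h0 h1
      refine ih ?_ h0
      rw [show a + 1 + 1 = a + 2 by ring, show a + m + 1 + 1 = a + m + 2 by ring, e1, e2, h0] at h1
      exact sub_right_injective h1
  obtain ⟨g0, g1⟩ := hback a h0 h1
  -- One further step back from the pair `(f 0, f 1)` at `m` reaches `f (m - 1) = f (-1) = 0`.
  obtain ⟨d, rfl⟩ : ∃ d, m = d + 1 := ⟨m - 1, by omega⟩
  have hz : f d X = 0 := by
    have e := f_add_two X d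
    rw [show d + 1 + 1 = d + 2 by ring, e, ← g0, f_zero, f_one, mul_one] at g1
    exact (sub_eq_self.mp g1.symm)
  refine ⟨d, ?_, hz⟩
  rcases Nat.eq_zero_or_pos d with rfl | hd
  · rw [f_zero] at hz
    exact absurd hz one_ne_zero
  · exact hd

lemma not_growsLinearly_of_bounded {X : Matrix ι ι ℤ}
    (hb : ∀ i j, ∃ C, ∀ k, |(f k X i j : ℝ)| ≤ C) : ¬ GrowsLinearly (fun k => f k X) := by
  choose C hC using hb
  intro h
  obtain ⟨c, hc, hk⟩ := h.2.exists_pos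
  obtain ⟨k₀, hk₀⟩ := Filter.eventually_atTop.mp hk.bound
  obtain ⟨k, hk1⟩ := exists_nat_gt (c * ∑ i, ∑ j, C i j)
  have h1 := hk₀ (max k k₀) (le_max_right _ _)
  have h2 : ∑ i, ∑ j, |(f (max k k₀) X i j : ℝ)| ≤ ∑ i, ∑ j, C i j :=
    sum_le_sum fun i _ => sum_le_sum fun j _ => hC i j _
  have h3 : (k : ℝ) ≤ (max k k₀ : ℕ) := by exact_mod_cast le_max_left _ _
  rw [Real.norm_of_nonneg (by positivity), Real.norm_of_nonneg
    (sum_nonneg fun i _ => sum_nonneg fun j _ => abs_nonneg _)] at h1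
  have := mul_le_mul_of_nonneg_left h2 hc.le
  linarith

/-- A positive integer vector with `X δ ≤ 2 δ`, not everywhere an equality, bounds the
sequence `f k X`. -/
lemma bounded_of_subharmonic {X : Matrix ι ι ℤ} (hX : X.IsSymm) (hX0 : ∀ i j, 0 ≤ X i j)
    (hind : IsIndecomposable X) {δ : ι → ℤ} (hδ : ∀ i, 0 < δ i)
    (hle : ∀ i, (X *ᵥ δ) i ≤ 2 * δ i) {i₀ : ι} (hlt : (X *ᵥ δ) i₀ < 2 * δ i₀) (i j : ι) :
    ∃ C, ∀ k, |(f k X i j : ℝ)| ≤ C := by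
  have hcast : ∀ i, (X.map (Int.cast : ℤ → ℝ) *ᵥ fun i => (δ i : ℝ)) i = ((X *ᵥ δ) i : ℤ) := by
    intro i
    simp [mulVec, dotProduct]
  refine bounded_of_recursion (isSymm_map_cast hX) (fun i j => by simpa using hX0 i j)
    (δ := fun i => (δ i : ℝ)) (fun i => by exact_mod_cast hδ i)
    (fun i => by rw [hcast]; exact_mod_cast hle i) (i₀ := i₀)
    (by rw [hcast]; exact_mod_cast hlt) (fun s hs hs' => ?_)
    (u := fun k i => (f k X i j : ℝ)) (f_col_recursion X j) i
  obtain ⟨a, ha, b, hb, hab⟩ := hind.2 s hs hs'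
  refine ⟨a, ha, b, hb, ?_⟩
  rw [hX.apply a b, or_self] at hab
  simpa using lt_of_le_of_ne (hX0 a b) (Ne.symm hab)

lemma f_mulVec_of_harmonic {X : Matrix ι ι ℤ} {δ : ι → ℤ} (h : X *ᵥ δ = (2 : ℤ) • δ) (k : ℕ) :
    f k X *ᵥ δ = ((k : ℤ) + 1) • δ ∧ f (k + 1) X *ᵥ δ = ((k : ℤ) + 2) • δ := by
  induction k with
  | zero => simp [f_zero, f_one, h]
  | succ k ih =>
    refine ⟨by rw [ih.2]; push_cast; congr 1, ?_⟩
    rw [f_add_two, sub_mulVec, ← mulVec_mulVec, ih.2, ih.1, mulVec_smul, h, smul_smul, ← sub_smul]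
    congr 1
    push_cast
    ring

lemma f_ne_zero_of_harmonic [Nonempty ι] {X : Matrix ι ι ℤ} {δ : ι → ℤ} (hδ : ∀ i, 0 < δ i)
    (h : X *ᵥ δ = (2 : ℤ) • δ) (k : ℕ) : f k X ≠ 0 := by
  intro h0
  have h1 := (f_mulVec_of_harmonic h k).1
  obtain ⟨i⟩ := ‹Nonempty ι›
  have h2 := congrFun h1 i
  rw [h0, zero_mulVec] at h2
  have h3 : 0 < ((k : ℤ) + 1) * δ i := mul_pos (by positivity) (hδ i)
  simp only [Pi.zero_apply, Pi.smul_apply, smul_eq_mul] at h2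
  omega

/-- A positive vector with `X δ = 2 δ` forces linear growth: from below because
`f k X δ = (k + 1) δ`, from above by the Schur test. -/
lemma growsLinearly_of_harmonic [Nonempty ι] {X : Matrix ι ι ℤ} (hX : X.IsSymm)
    (hX0 : ∀ i j, 0 ≤ X i j) {δ : ι → ℤ} (hδ : ∀ i, 0 < δ i) (h : X *ᵥ δ = (2 : ℤ) • δ) :
    GrowsLinearly (fun k => f k X) := by
  have hcast : ∀ i, (X.map (Int.cast : ℤ → ℝ) *ᵥ fun i => (δ i : ℝ)) i = ((X *ᵥ δ) i : ℤ) := by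
    intro i
    simp [mulVec, dotProduct]
  have hS := schur_test (isSymm_map_cast hX) (fun i j => by simpa using hX0 i j)
    (δ := fun i => (δ i : ℝ)) (fun i => by exact_mod_cast hδ i)
    (fun i => by rw [hcast, h]; simp)
  have hcol : ∀ j, ∃ C, ∀ (k : ℕ) (i : ι), |(f k X i j : ℝ)| ≤ C * (k + 1) := fun j =>
    linear_bound_of_recursion (isSymm_map_cast hX) hS
      (u := fun k i => (f k X i j : ℝ)) (f_col_recursion X j)
  choose C hC using hcol
  have hnn : ∀ k, 0 ≤ ∑ i, ∑ j, |(f k X i j : ℝ)| := fun k =>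
    sum_nonneg fun i _ => sum_nonneg fun j _ => abs_nonneg _
  constructor
  · refine Asymptotics.IsBigO.of_bound (2 * ∑ _i : ι, ∑ j, |C j|) ?_
    filter_upwards [Filter.eventually_ge_atTop 1] with k hk
    have hk' : (1 : ℝ) ≤ k := by exact_mod_cast hk
    rw [Real.norm_of_nonneg (hnn k), Real.norm_of_nonneg (by positivity)]
    calc ∑ i, ∑ j, |(f k X i j : ℝ)| ≤ ∑ _i : ι, ∑ j, |C j| * (2 * k) := by
          refine sum_le_sum fun i _ => sum_le_sum fun j _ => (hC j k i).trans ?_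
          exact mul_le_mul (le_abs_self _) (by linarith) (by positivity) (abs_nonneg _)
      _ = 2 * (∑ _i : ι, ∑ j, |C j|) * k := by
          simp only [← sum_mul]
          ring
  · obtain ⟨i⟩ := ‹Nonempty ι›
    refine Asymptotics.IsBigO.of_bound (∑ j, (δ j : ℝ)) (Filter.Eventually.of_forall fun k => ?_)
    rw [Real.norm_of_nonneg (hnn k), Real.norm_of_nonneg (by positivity)]
    have h1 := congrFun (f_mulVec_of_harmonic h k).1 i
    have h2 : ∑ j, (f k X i j : ℝ) * (δ j : ℝ) = ((k : ℝ) + 1) * δ i := by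
      simp only [mulVec, dotProduct, Pi.smul_apply, smul_eq_mul] at h1
      exact_mod_cast h1
    have h3 : (1 : ℝ) ≤ δ i := by exact_mod_cast hδ i
    have hδ0 : ∀ j, (0 : ℝ) ≤ δ j := fun j => by exact_mod_cast (hδ j).le
    calc (k : ℝ) ≤ ((k : ℝ) + 1) * δ i := by nlinarith [(Nat.cast_nonneg k : (0 : ℝ) ≤ k)]
      _ = ∑ j, (f k X i j : ℝ) * (δ j : ℝ) := h2.symm
      _ ≤ ∑ j, (δ j : ℝ) * ∑ i, ∑ j, |(f k X i j : ℝ)| := by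
          refine sum_le_sum fun j _ => ?_
          rw [mul_comm]
          refine mul_le_mul_of_nonneg_left ((le_abs_self _).trans ?_) (hδ0 j)
          exact (single_le_sum (f := fun j => |(f k X i j : ℝ)|) (fun j _ => abs_nonneg _)
            (mem_univ j)).trans (single_le_sum (f := fun i => ∑ j, |(f k X i j : ℝ)|)
              (fun i _ => sum_nonneg fun j _ => abs_nonneg _) (mem_univ i))
      _ = (∑ j, (δ j : ℝ)) * ∑ i, ∑ j, |(f k X i j : ℝ)| := by rw [sum_mul]

/-- At an eigenvalue `lam > 2` the Chebyshev recursion grows quadratically (in fact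
exponentially). -/
lemma chebyshev_quadratic_growth {lam : ℝ} (hlam : 2 < lam) {c : ℕ → ℝ} (h0 : c 0 = 1)
    (h1 : c 1 = lam) (hc : ∀ k, c (k + 2) = lam * c (k + 1) - c k) (k : ℕ) :
    1 + (lam - 2) * k ^ 2 / 2 ≤ c k := by
  have key : ∀ k : ℕ, 1 + (lam - 2) * k ^ 2 / 2 ≤ c k ∧
      1 + (lam - 2) * (k + 1) ≤ c (k + 1) - c k := by
    intro k
    induction k with
    | zero => exact ⟨by simp [h0], by rw [zero_add, h0, h1]; push_cast; linarith⟩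
    | succ k ih =>
      have hk : (0 : ℝ) ≤ k := by positivity
      have h2 : 1 + (lam - 2) * ((k + 1 : ℕ) : ℝ) ^ 2 / 2 ≤ c (k + 1) := by
        push_cast
        nlinarith
      refine ⟨h2, ?_⟩
      have h3 : 1 ≤ c (k + 1) := by
        refine le_trans ?_ h2
        have : 0 ≤ (lam - 2) * ((k + 1 : ℕ) : ℝ) ^ 2 / 2 :=
          div_nonneg (mul_nonneg (by linarith) (sq_nonneg _)) zero_le_two
        linarith
      rw [show k + 1 + 1 = k + 2 from rfl, hc]
      push_cast
      nlinarith [ih.2]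
  exact (key k).1

/-- If the form `2 - X` takes a negative value, then `X` has an eigenvector along which `f k X` acts
by factors of quadratic growth. -/
lemma exists_growing_eigenvector {X : Matrix ι ι ℤ} (hX : X.IsSymm) {v : ι → ℤ}
    (hv : 2 * (v ⬝ᵥ v) < v ⬝ᵥ X *ᵥ v) :
    ∃ (w : ι → ℝ) (c : ℕ → ℝ) (ε : ℝ), w ≠ 0 ∧ 0 < ε ∧ (∀ k : ℕ, 1 + ε * k ^ 2 ≤ c k) ∧
      ∀ k i, ∑ j, (f k X i j : ℝ) * w j = c k * w i := by
  set Y : Matrix ι ι ℝ := X.map (Int.cast : ℤ → ℝ) with hYdef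
  have hA : ((2 : ℝ) • (1 : Matrix ι ι ℝ) - Y).IsHermitian := by
    rw [Matrix.IsHermitian, Matrix.conjTranspose_eq_transpose_of_trivial]
    simp [(isSymm_map_cast hX).eq, hYdef]
  have hneg : ∃ a, hA.eigenvalues a < 0 := by
    by_contra! hcon
    have hp := (hA.posSemidef_iff_eigenvalues_nonneg.mpr hcon).dotProduct_mulVec_nonneg
      (fun i => (v i : ℝ))
    have h2 : (fun i => (v i : ℝ)) ⬝ᵥ Y *ᵥ (fun i => (v i : ℝ)) = ((v ⬝ᵥ X *ᵥ v : ℤ) : ℝ) := by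
      simp [hYdef, dotProduct, mulVec]
    have h3 : (fun i => (v i : ℝ)) ⬝ᵥ (fun i => (v i : ℝ)) = ((v ⬝ᵥ v : ℤ) : ℝ) := by
      simp [dotProduct]
    have hv' : (2 : ℝ) * ((v ⬝ᵥ v : ℤ) : ℝ) < ((v ⬝ᵥ X *ᵥ v : ℤ) : ℝ) := by exact_mod_cast hv
    simp only [star_trivial, sub_mulVec, smul_mulVec, one_mulVec, dotProduct_sub,
      dotProduct_smul, smul_eq_mul, h2, h3] at hp
    linarith
  obtain ⟨a, ha⟩ := hneg
  set lam := 2 - hA.eigenvalues a with hlam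
  let w : ι → ℝ := hA.eigenvectorBasis a
  have hw : w ≠ 0 := by
    intro h0
    refine hA.eigenvectorBasis.toBasis.ne_zero a ?_
    ext i
    simpa using congrFun h0 i
  have hYw : Y *ᵥ w = lam • w := by
    have h1 : ((2 : ℝ) • (1 : Matrix ι ι ℝ) - Y) *ᵥ w = hA.eigenvalues a • w :=
      hA.mulVec_eigenvectorBasis a
    rw [sub_mulVec, smul_mulVec, one_mulVec] at h1
    rw [hlam, sub_smul, ← h1]
    abel
  let c : ℕ → ℝ := fun k => (Polynomial.Chebyshev.S ℝ (k : ℤ)).eval lam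
  have hc : ∀ k, c (k + 2) = lam * c (k + 1) - c k := by
    intro k
    simp [c, Polynomial.Chebyshev.S_add_two]
  have hc0 : c 0 = 1 := by simp [c]
  have hc1 : c 1 = lam := by simp [c]
  refine ⟨w, c, (lam - 2) / 2, hw, by rw [hlam]; linarith, fun k => ?_, ?_⟩
  · have := chebyshev_quadratic_growth (lam := lam) (by rw [hlam]; linarith) hc0 hc1 hc k
    linarith
  · have hact : ∀ k, (f k X).map (Int.cast : ℤ → ℝ) *ᵥ w = c k • w ∧
        (f (k + 1) X).map (Int.cast : ℤ → ℝ) *ᵥ w = c (k + 1) • w := by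
      intro k
      induction k with
      | zero =>
        refine ⟨?_, ?_⟩
        · rw [f_zero, Matrix.map_one _ Int.cast_zero Int.cast_one, one_mulVec, hc0, one_smul]
        · rw [zero_add, f_one, hc1]
          exact hYw
      | succ k ih =>
        refine ⟨ih.2, ?_⟩
        have h1 : (f (k + 2) X).map (Int.cast : ℤ → ℝ) =
            Y * (f (k + 1) X).map (Int.cast : ℤ → ℝ) - (f k X).map (Int.cast : ℤ → ℝ) := by
          ext i j
          simp [f_add_two, Matrix.mul_apply, hYdef]
        rw [show k + 1 + 1 = k + 2 from rfl, h1, sub_mulVec, ← mulVec_mulVec, ih.2, ih.1,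
          mulVec_smul, hYw, smul_smul, ← sub_smul, hc]
        congr 1
        ring
    intro k i
    have := congrFun (hact k).1 i
    simpa [mulVec, dotProduct] using this

lemma form_le_of_f_eq_zero {X : Matrix ι ι ℤ} (hX : X.IsSymm) {d : ℕ} (hd : f d X = 0)
    (v : ι → ℤ) : v ⬝ᵥ X *ᵥ v ≤ 2 * (v ⬝ᵥ v) := by
  by_contra! hv
  obtain ⟨w, c, ε, hw, hε, hc, hact⟩ := exists_growing_eigenvector hX hv
  obtain ⟨i, hi⟩ := Function.ne_iff.mp hw
  have h1 := hact d i
  have h2 : 0 < c d := lt_of_lt_of_le (by positivity) (hc d)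
  rw [hd] at h1
  simp only [Matrix.zero_apply, Int.cast_zero, zero_mul, sum_const_zero] at h1
  exact mul_ne_zero h2.ne' hi h1.symm

lemma form_le_of_growsLinearly {X : Matrix ι ι ℤ} (hX : X.IsSymm)
    (hlin : GrowsLinearly (fun k => f k X)) (v : ι → ℤ) : v ⬝ᵥ X *ᵥ v ≤ 2 * (v ⬝ᵥ v) := by
  by_contra! hv
  obtain ⟨w, c, ε, hw, hε, hc, hact⟩ := exists_growing_eigenvector hX hv
  obtain ⟨i, hi⟩ := Function.ne_iff.mp hw
  obtain ⟨C, hC, hk⟩ := hlin.1.exists_pos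
  obtain ⟨k₀, hk₀⟩ := Filter.eventually_atTop.mp hk.bound
  have hi' : 0 < |w i| := abs_pos.mpr hi
  set M := ∑ j, |w j| with hM
  have hM0 : 0 ≤ M := sum_nonneg fun j _ => abs_nonneg _
  obtain ⟨n, hn⟩ := exists_nat_gt (C * M / (ε * |w i|))
  set k := max n (max k₀ 1) with hkdef
  have hk1 : (1 : ℝ) ≤ k := by exact_mod_cast (le_max_right k₀ 1).trans (le_max_right n _)
  have hkn : (n : ℝ) ≤ k := by exact_mod_cast le_max_left n _
  have hb := hk₀ k ((le_max_left k₀ 1).trans (le_max_right n _))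
  rw [Real.norm_of_nonneg (sum_nonneg fun i _ => sum_nonneg fun j _ => abs_nonneg _),
    Real.norm_of_nonneg (by positivity)] at hb
  have h1 : c k * |w i| ≤ C * k * M := by
    have hck : 0 < c k := lt_of_lt_of_le (by positivity) (hc k)
    rw [← abs_of_pos hck, ← abs_mul, ← hact k i]
    refine (abs_sum_le_sum_abs _ _).trans ?_
    rw [hM, mul_sum]
    refine sum_le_sum fun j _ => ?_
    rw [abs_mul]
    refine mul_le_mul_of_nonneg_right (le_trans ?_ hb) (abs_nonneg _)
    exact (single_le_sum (f := fun j => |(f k X i j : ℝ)|) (fun j _ => abs_nonneg _)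
      (mem_univ j)).trans (single_le_sum (f := fun i => ∑ j, |(f k X i j : ℝ)|)
        (fun i _ => sum_nonneg fun j _ => abs_nonneg _) (mem_univ i))
  have h2 : C * M < k * (ε * |w i|) := by
    rw [div_lt_iff₀ (mul_pos hε hi')] at hn
    exact hn.trans_le (mul_le_mul_of_nonneg_right hkn (mul_pos hε hi').le)
  have h3 : (1 + ε * k ^ 2) * |w i| ≤ c k * |w i| := mul_le_mul_of_nonneg_right (hc k) hi'.le
  nlinarith [mul_lt_mul_of_pos_left h2 (by linarith : (0 : ℝ) < k)]

end Growth

/-! ### Harmonic and subharmonic functions on the diagrams -/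

/-- The contribution of an edge to the sum of `δ` over the neighbours of the vertex `a`. A loop at
`a` contributes `δ a` once. -/
def edgeWeight (δ : ℕ → ℤ) (a : ℕ) : Sym2 ℕ → ℤ :=
  Sym2.lift ⟨fun x y => if x = a then δ y else if y = a then δ x else 0, by
    intro x y
    dsimp only
    split_ifs <;> simp_all⟩

@[simp] lemma edgeWeight_mk (δ : ℕ → ℤ) (a x y : ℕ) :
    edgeWeight δ a s(x, y) = if x = a then δ y else if y = a then δ x else 0 := rfl

/-- The sum of `δ` over the neighbours of the vertex `a`, with multiplicity. -/
def Diagram.neighborSum (G : Diagram) (δ : ℕ → ℤ) (a : ℕ) : ℤ :=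
  (G.edges.map (edgeWeight δ a)).sum

lemma sum_map_edgeWeight_path (δ : ℕ → ℤ) (a m n : ℕ) :
    ((path m n).map (edgeWeight δ a)).sum =
      (if m ≤ a ∧ a < n then δ (a + 1) else 0) + (if m < a ∧ a ≤ n then δ (a - 1) else 0) := by
  have h : ((path m n).map (edgeWeight δ a)).sum =
      ∑ i ∈ Ico m n, (if i = a then δ (i + 1) else if i + 1 = a then δ i else 0) := by
    rw [path, Multiset.map_map]
    rfl
  rw [h]
  have h2 : ∀ i, (if i = a then δ (i + 1) else if i + 1 = a then δ i else 0) =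
      (if i = a then δ (a + 1) else 0) + (if i + 1 = a then δ (a - 1) else 0) := by
    intro i
    split_ifs <;> first | omega | (subst_vars; simp)
  simp only [h2, sum_add_distrib, sum_ite_eq', mem_Ico]
  congr 1
  rcases Nat.eq_zero_or_pos a with rfl | ha
  · simp
  · obtain ⟨b, rfl⟩ : ∃ b, a = b + 1 := ⟨a - 1, by omega⟩
    simp

/-- All edges of `G` join vertices in the range `1, …, size`. -/
def Diagram.EdgesInRange (G : Diagram) : Prop :=
  ∀ e ∈ G.edges, ∀ x ∈ e, 1 ≤ x ∧ x ≤ G.size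

/-- The sum of `δ` over the neighbours of `a`, computed vertex by vertex and edge by edge. -/
lemma sum_count_mul {E : Multiset (Sym2 ℕ)} {n : ℕ}
    (hE : ∀ e ∈ E, ∀ x ∈ e, 1 ≤ x ∧ x ≤ n) (δ : ℕ → ℤ) (a : ℕ) :
    ∑ b ∈ Icc 1 n, (E.count s(a, b) : ℤ) * δ b = (E.map (edgeWeight δ a)).sum := by
  induction E using Multiset.induction with
  | empty => simp
  | cons e E ih =>
    have hE' : ∀ e ∈ E, ∀ x ∈ e, 1 ≤ x ∧ x ≤ n := fun e' he' =>
      hE e' (Multiset.mem_cons_of_mem he')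
    have he := hE e (Multiset.mem_cons_self e E)
    rw [Multiset.map_cons, Multiset.sum_cons, ← ih hE']
    simp only [Multiset.count_cons, Nat.cast_add, add_mul, sum_add_distrib]
    rw [add_comm]
    congr 1
    induction e with
    | _ x y =>
      have hx := he x (Sym2.mem_mk_left x y)
      have hy := he y (Sym2.mem_mk_right x y)
      rw [edgeWeight_mk]
      have h1 : ∀ b, ((if s(a, b) = s(x, y) then 1 else 0 : ℕ) : ℤ) * δ b =
          if x = a then (if b = y then δ y else 0)
            else if y = a then (if b = x then δ x else 0) else 0 := by
        intro b
        simp only [Sym2.eq_iff]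
        split_ifs <;> first | omega | simp_all
      simp only [h1]
      split_ifs <;> simp [hx, hy]

lemma adjMatrix_mulVec {G : Diagram} (hG : G.EdgesInRange) (δ : ℕ → ℤ) (a : Fin G.size) :
    (G.adjMatrix *ᵥ fun i => δ ((i : ℕ) + 1)) a = G.neighborSum δ ((a : ℕ) + 1) := by
  rw [Diagram.neighborSum, ← sum_count_mul hG, mulVec, dotProduct]
  simp only [Diagram.adjMatrix]
  rw [Fin.sum_univ_eq_sum_range
    (fun i => (G.edges.count s((a : ℕ) + 1, i + 1) : ℤ) * δ (i + 1)) G.size,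
    ← Nat.Ico_zero_eq_range,
    Finset.sum_Ico_add' (fun i => (G.edges.count s((a : ℕ) + 1, i) : ℤ) * δ i) 0 G.size 1]
  rfl

lemma mulVec_of_isAdjMatrixOf {ι : Type*} [Fintype ι] {X : Matrix ι ι ℤ} {G : Diagram}
    (hG : G.EdgesInRange) (δ : ℕ → ℤ) (e : ι ≃ Fin G.size) (he : X = G.adjMatrix.submatrix e e)
    (i : ι) :
    (X *ᵥ fun i => δ ((e i : ℕ) + 1)) i = G.neighborSum δ ((e i : ℕ) + 1) := by
  rw [← adjMatrix_mulVec hG, he]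
  simp only [mulVec, dotProduct, submatrix_apply]
  exact e.sum_comp fun j => G.adjMatrix (e i) j * δ ((j : ℕ) + 1)

/-- The positive integer function `δ` on the vertices of `G` is harmonic: the sum of its values over
the neighbours of any vertex `a` is `2 δ a`. -/
structure Diagram.IsHarmonic (G : Diagram) (δ : ℕ → ℤ) : Prop where
  one_le_size : 1 ≤ G.size
  inRange : G.EdgesInRange
  pos : ∀ a, 1 ≤ a → a ≤ G.size → 0 < δ a
  eq : ∀ a, 1 ≤ a → a ≤ G.size → G.neighborSum δ a = 2 * δ a

/-- The positive integer function `δ` on the vertices of `G` satisfies the harmonicity equation with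
`≤`, the inequality being strict at some vertex. -/
structure Diagram.IsSubharmonic (G : Diagram) (δ : ℕ → ℤ) : Prop where
  inRange : G.EdgesInRange
  pos : ∀ a, 1 ≤ a → a ≤ G.size → 0 < δ a
  le : ∀ a, 1 ≤ a → a ≤ G.size → G.neighborSum δ a ≤ 2 * δ a
  lt : ∃ a, 1 ≤ a ∧ a ≤ G.size ∧ G.neighborSum δ a < 2 * δ a

lemma mem_path {m n : ℕ} {e : Sym2 ℕ} : e ∈ path m n ↔ ∃ i, m ≤ i ∧ i < n ∧ s(i, i + 1) = e := by
  simp [path, and_assoc]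

section Harmonic

lemma isHarmonic_typeTildeA {n : ℕ} (hn : 1 ≤ n) :
    (typeTildeA n).IsHarmonic fun _ => 1 := by
  refine ⟨by simp [typeTildeA], ?_, fun _ _ _ => one_pos, ?_⟩
  · intro e he x hx
    simp only [typeTildeA, Multiset.mem_add, mem_path, Multiset.mem_singleton] at he ⊢
    rcases he with ⟨i, h1, h2, rfl⟩ | rfl <;> simp only [Sym2.mem_iff] at hx <;> omega
  · intro a h1 h2
    simp only [Diagram.neighborSum, typeTildeA, Multiset.map_add, Multiset.sum_add,
      sum_map_edgeWeight_path, Multiset.map_singleton, Multiset.sum_singleton,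
      edgeWeight_mk] at h2 ⊢
    split_ifs <;> omega

lemma isHarmonic_typeTildeD {n : ℕ} (hn : 4 ≤ n) :
    (typeTildeD n).IsHarmonic fun a => if a ≤ 2 ∨ n ≤ a then 1 else 2 := by
  refine ⟨by simp [typeTildeD], ?_, fun _ _ _ => by split_ifs <;> norm_num, ?_⟩
  · intro e he x hx
    simp only [typeTildeD, Multiset.mem_add, mem_path, Multiset.mem_singleton,
      Multiset.insert_eq_cons, Multiset.mem_cons] at he ⊢
    rcases he with ((rfl | rfl) | ⟨i, h1, h2, rfl⟩) | rfl | rfl <;>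
      simp only [Sym2.mem_iff] at hx <;> omega
  · intro a h1 h2
    have h2' : a ≤ n + 1 := h2
    have e1 : (if 3 ≤ a ∧ a < n - 1 then (if a + 1 ≤ 2 ∨ n ≤ a + 1 then 1 else 2) else 0 : ℤ) =
        if 3 ≤ a ∧ a < n - 1 then 2 else 0 := by
      split_ifs <;> first | rfl | omega
    have e2 : (if 3 < a ∧ a ≤ n - 1 then (if a - 1 ≤ 2 ∨ n ≤ a - 1 then 1 else 2) else 0 : ℤ) =
        if 3 < a ∧ a ≤ n - 1 then 2 else 0 := by
      split_ifs <;> first | rfl | omega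
    have c1 : ¬ (3 ≤ 2 ∨ n ≤ 3) := by omega
    have c2 : ¬ (n - 1 ≤ 2 ∨ n ≤ n - 1) := by omega
    simp only [Diagram.neighborSum, typeTildeD, Multiset.map_add, Multiset.sum_add,
      sum_map_edgeWeight_path, Multiset.map_singleton, Multiset.sum_singleton,
      Multiset.insert_eq_cons, Multiset.map_cons, Multiset.sum_cons, edgeWeight_mk, e1, e2,
      if_neg c1, if_neg c2, le_refl, true_or, or_true, if_true, Nat.le_add_right,
      show (1 : ℕ) ≤ 2 by norm_num]
    rcases lt_or_ge a 3 with h3 | h3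
    · interval_cases a <;> split_ifs <;> omega
    · rcases lt_or_ge a n with h4 | h4
      · rw [if_neg (by omega : ¬ 1 = a), if_neg (by omega : ¬ 2 = a), if_neg (by omega : ¬ n = a),
          if_neg (by omega : ¬ n + 1 = a), if_neg (by omega : ¬ (a ≤ 2 ∨ n ≤ a))]
        split_ifs <;> omega
      · split_ifs <;> omega

lemma isHarmonic_typeTildeL {n : ℕ} (hn : 1 ≤ n) :
    (typeTildeL n).IsHarmonic fun _ => 1 := by
  refine ⟨hn, ?_, fun _ _ _ => one_pos, ?_⟩
  · intro e he x hx
    simp only [typeTildeL, Multiset.mem_add, mem_path, Multiset.mem_singleton] at he ⊢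
    rcases he with (rfl | ⟨i, h1, h2, rfl⟩) | rfl <;> simp only [Sym2.mem_iff] at hx <;> omega
  · intro a h1 h2
    simp only [Diagram.neighborSum, typeTildeL, Multiset.map_add, Multiset.sum_add,
      sum_map_edgeWeight_path, Multiset.map_singleton, Multiset.sum_singleton,
      edgeWeight_mk] at h2 ⊢
    split_ifs <;> omega

lemma isHarmonic_typeTildeDL {n : ℕ} (hn : 3 ≤ n) :
    (typeTildeDL n).IsHarmonic fun a => if a ≤ 2 then 1 else 2 := by
  refine ⟨by simp only [typeTildeDL]; omega, ?_, fun _ _ _ => by split_ifs <;> norm_num, ?_⟩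
  · intro e he x hx
    simp only [typeTildeDL, Multiset.mem_add, mem_path, Multiset.mem_singleton,
      Multiset.insert_eq_cons, Multiset.mem_cons] at he ⊢
    rcases he with ((rfl | rfl) | ⟨i, h1, h2, rfl⟩) | rfl <;>
      simp only [Sym2.mem_iff] at hx <;> omega
  · intro a h1 h2
    simp only [Diagram.neighborSum, typeTildeDL, Multiset.map_add, Multiset.sum_add,
      sum_map_edgeWeight_path, Multiset.map_singleton, Multiset.sum_singleton,
      Multiset.insert_eq_cons, Multiset.map_cons, Multiset.sum_cons,
      edgeWeight_mk] at h2 ⊢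
    split_ifs <;> omega

/-- The function on the labels `1, 2, …` with the given list of values. -/
def ofList (l : List ℤ) (a : ℕ) : ℤ := l.getD (a - 1) 1

lemma isHarmonic_typeTildeE6 : typeTildeE6.IsHarmonic (ofList [1, 2, 3, 2, 1, 2, 1]) := by
  refine ⟨by simp [typeTildeE6], ?_, ?_, ?_⟩
  · intro e he x hx
    simp only [typeTildeE6, Multiset.mem_add, mem_path, Multiset.mem_singleton,
      Multiset.insert_eq_cons, Multiset.mem_cons] at he ⊢
    rcases he with ⟨i, h1, h2, rfl⟩ | rfl | rfl <;> simp only [Sym2.mem_iff] at hx <;> omega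
  · intro a h1 h2
    simp only [typeTildeE6] at h2
    interval_cases a <;> decide
  · intro a h1 h2
    simp only [Diagram.neighborSum, typeTildeE6, Multiset.map_add, Multiset.sum_add,
      sum_map_edgeWeight_path, Multiset.map_singleton, Multiset.sum_singleton,
      Multiset.insert_eq_cons, Multiset.map_cons, Multiset.sum_cons,
      edgeWeight_mk] at h2 ⊢
    interval_cases a <;> decide

lemma isHarmonic_typeTildeE7 : typeTildeE7.IsHarmonic (ofList [2, 3, 4, 3, 2, 1, 2, 1]) := by
  refine ⟨by simp [typeTildeE7], ?_, ?_, ?_⟩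
  · intro e he x hx
    simp only [typeTildeE7, Multiset.mem_add, mem_path, Multiset.mem_singleton,
      Multiset.insert_eq_cons, Multiset.mem_cons] at he ⊢
    rcases he with ⟨i, h1, h2, rfl⟩ | rfl | rfl <;> simp only [Sym2.mem_iff] at hx <;> omega
  · intro a h1 h2
    simp only [typeTildeE7] at h2
    interval_cases a <;> decide
  · intro a h1 h2
    simp only [Diagram.neighborSum, typeTildeE7, Multiset.map_add, Multiset.sum_add,
      sum_map_edgeWeight_path, Multiset.map_singleton, Multiset.sum_singleton,
      Multiset.insert_eq_cons, Multiset.map_cons, Multiset.sum_cons,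
      edgeWeight_mk] at h2 ⊢
    interval_cases a <;> decide

lemma isHarmonic_typeTildeE8 : typeTildeE8.IsHarmonic (ofList [2, 4, 6, 5, 4, 3, 2, 3, 1]) := by
  refine ⟨by simp [typeTildeE8], ?_, ?_, ?_⟩
  · intro e he x hx
    simp only [typeTildeE8, Multiset.mem_add, mem_path, Multiset.mem_singleton,
      Multiset.insert_eq_cons, Multiset.mem_cons] at he ⊢
    rcases he with ⟨i, h1, h2, rfl⟩ | rfl | rfl <;> simp only [Sym2.mem_iff] at hx <;> omega
  · intro a h1 h2
    simp only [typeTildeE8] at h2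
    interval_cases a <;> decide
  · intro a h1 h2
    simp only [Diagram.neighborSum, typeTildeE8, Multiset.map_add, Multiset.sum_add,
      sum_map_edgeWeight_path, Multiset.map_singleton, Multiset.sum_singleton,
      Multiset.insert_eq_cons, Multiset.map_cons, Multiset.sum_cons,
      edgeWeight_mk] at h2 ⊢
    interval_cases a <;> decide

lemma exists_isHarmonic {G : Diagram} (hG : IsTypeTilde G) : ∃ δ, G.IsHarmonic δ := by
  rcases hG with ⟨n, hn, rfl⟩ | ⟨n, hn, rfl⟩ | (rfl | rfl | rfl) | ⟨n, hn, rfl⟩ | ⟨n, hn, rfl⟩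
  · exact ⟨_, isHarmonic_typeTildeA hn⟩
  · exact ⟨_, isHarmonic_typeTildeD hn⟩
  · exact ⟨_, isHarmonic_typeTildeE6⟩
  · exact ⟨_, isHarmonic_typeTildeE7⟩
  · exact ⟨_, isHarmonic_typeTildeE8⟩
  · exact ⟨_, isHarmonic_typeTildeL hn⟩
  · exact ⟨_, isHarmonic_typeTildeDL hn⟩

lemma isSubharmonic_typeA {n : ℕ} (hn : 1 ≤ n) : (typeA n).IsSubharmonic fun _ => 1 := by
  have h : ∀ a, (typeA n).neighborSum (fun _ => 1) a =
      (if 1 ≤ a ∧ a < n then 1 else 0) + (if 1 < a ∧ a ≤ n then 1 else 0) := by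
    intro a
    simp only [Diagram.neighborSum, typeA, sum_map_edgeWeight_path]
  refine ⟨?_, fun _ _ _ => one_pos, ?_, 1, le_rfl, hn, ?_⟩
  · intro e he x hx
    simp only [typeA, mem_path] at he ⊢
    rcases he with ⟨i, h1, h2, rfl⟩
    simp only [Sym2.mem_iff] at hx
    omega
  · intro a h1 h2
    rw [h]
    split_ifs <;> omega
  · rw [h]
    split_ifs <;> omega

lemma isSubharmonic_typeL {n : ℕ} (hn : 1 ≤ n) : (typeL n).IsSubharmonic fun _ => 1 := by
  have h : ∀ a, (typeL n).neighborSum (fun _ => 1) a = (if 1 = a then 1 else 0) +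
      ((if 1 ≤ a ∧ a < n then 1 else 0) + (if 1 < a ∧ a ≤ n then 1 else 0)) := by
    intro a
    simp only [Diagram.neighborSum, typeL, Multiset.map_add, Multiset.sum_add,
      sum_map_edgeWeight_path, Multiset.map_singleton, Multiset.sum_singleton, edgeWeight_mk]
    split_ifs <;> omega
  refine ⟨?_, fun _ _ _ => one_pos, ?_, n, hn, le_rfl, ?_⟩
  · intro e he x hx
    simp only [typeL, Multiset.mem_add, mem_path, Multiset.mem_singleton] at he ⊢
    rcases he with rfl | ⟨i, h1, h2, rfl⟩ <;> simp only [Sym2.mem_iff] at hx <;> omega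
  · intro a h1 h2
    rw [h]
    split_ifs <;> omega
  · rw [h]
    split_ifs <;> omega

lemma isSubharmonic_typeD {n : ℕ} (hn : 4 ≤ n) :
    (typeD n).IsSubharmonic fun a => if a ≤ 2 then 1 else 2 := by
  refine ⟨?_, fun _ _ _ => by split_ifs <;> norm_num, ?_, n, by omega, le_rfl, ?_⟩
  · intro e he x hx
    simp only [typeD, Multiset.mem_add, mem_path, Multiset.mem_singleton,
      Multiset.insert_eq_cons, Multiset.mem_cons] at he ⊢
    rcases he with (rfl | rfl) | ⟨i, h1, h2, rfl⟩ <;> simp only [Sym2.mem_iff] at hx <;> omega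
  · intro a h1 h2
    simp only [Diagram.neighborSum, typeD, Multiset.map_add, Multiset.sum_add,
      sum_map_edgeWeight_path, Multiset.map_singleton, Multiset.sum_singleton,
      Multiset.insert_eq_cons, Multiset.map_cons, Multiset.sum_cons, edgeWeight_mk] at h2 ⊢
    split_ifs <;> omega
  · simp only [Diagram.neighborSum, typeD, Multiset.map_add, Multiset.sum_add,
      sum_map_edgeWeight_path, Multiset.map_singleton, Multiset.sum_singleton,
      Multiset.insert_eq_cons, Multiset.map_cons, Multiset.sum_cons, edgeWeight_mk]
    split_ifs <;> omega

lemma edgesInRange_typeE {n : ℕ} (hn : 4 ≤ n) : (typeE n).EdgesInRange := by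
  intro e he x hx
  simp only [typeE, Multiset.mem_add, mem_path, Multiset.mem_singleton] at he ⊢
  rcases he with ⟨i, h1, h2, rfl⟩ | rfl <;> simp only [Sym2.mem_iff] at hx <;> omega

/-- The values for `E₆`, `E₇`, `E₈` are those of the harmonic functions on the extended diagrams,
which have one further vertex. -/
lemma exists_isSubharmonic_typeE {n : ℕ} (h6 : 6 ≤ n) (h8 : n ≤ 8) :
    ∃ δ, (typeE n).IsSubharmonic δ := by
  have hsum : ∀ n δ a, (typeE n).neighborSum δ a =
      (if 1 ≤ a ∧ a < n - 1 then δ (a + 1) else 0) + (if 1 < a ∧ a ≤ n - 1 then δ (a - 1) else 0) +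
        (if 3 = a then δ n else if n = a then δ 3 else 0) := by
    intro n δ a
    simp only [Diagram.neighborSum, typeE, Multiset.map_add, Multiset.sum_add,
      sum_map_edgeWeight_path, Multiset.map_singleton, Multiset.sum_singleton, edgeWeight_mk]
  have hsz : ∀ n, (typeE n).size = n := fun n => rfl
  interval_cases n
  · refine ⟨ofList [1, 2, 3, 2, 1, 2], edgesInRange_typeE (by norm_num), ?_, ?_,
      6, by simp, by simp [hsz], by rw [hsum]; decide⟩ <;> intro a h1 h2 <;>
      rw [hsz] at h2 <;> (try rw [hsum]) <;> interval_cases a <;> decide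
  · refine ⟨ofList [2, 3, 4, 3, 2, 1, 2], edgesInRange_typeE (by norm_num), ?_, ?_,
      1, by simp, by simp [hsz], by rw [hsum]; decide⟩ <;> intro a h1 h2 <;>
      rw [hsz] at h2 <;> (try rw [hsum]) <;> interval_cases a <;> decide
  · refine ⟨ofList [2, 4, 6, 5, 4, 3, 2, 3], edgesInRange_typeE (by norm_num), ?_,
      ?_, 7, by simp, by simp [hsz], by rw [hsum]; decide⟩ <;> intro a h1 h2 <;>
      rw [hsz] at h2 <;> (try rw [hsum]) <;> interval_cases a <;> decide

lemma exists_isSubharmonic {G : Diagram} (hG : IsTypeADEL G) : ∃ δ, G.IsSubharmonic δ := by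
  rcases hG with ⟨n, hn, rfl⟩ | ⟨n, hn, rfl⟩ | (rfl | rfl | rfl) | ⟨n, hn, rfl⟩
  · exact ⟨_, isSubharmonic_typeA hn⟩
  · exact ⟨_, isSubharmonic_typeD hn⟩
  · exact exists_isSubharmonic_typeE (by norm_num) (by norm_num)
  · exact exists_isSubharmonic_typeE (by norm_num) (by norm_num)
  · exact exists_isSubharmonic_typeE (by norm_num) (by norm_num)
  · exact ⟨_, isSubharmonic_typeL hn⟩

end Harmonic

section Consequences

variable {ι : Type*} [Fintype ι] {X : Matrix ι ι ℤ}

lemma exists_harmonic_of_isTypeTilde {G : Diagram} (hG : IsTypeTilde G)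
    (hXG : IsAdjMatrixOf X G) : ∃ δ : ι → ℤ, (∀ i, 0 < δ i) ∧ X *ᵥ δ = (2 : ℤ) • δ := by
  obtain ⟨δ, hδ⟩ := exists_isHarmonic hG
  obtain ⟨e, he⟩ := hXG
  refine ⟨fun i => δ ((e i : ℕ) + 1), fun i => hδ.pos _ (by omega) (e i).isLt, ?_⟩
  ext i
  rw [mulVec_of_isAdjMatrixOf hδ.inRange δ e he, hδ.eq _ (by omega) (e i).isLt]
  rfl

lemma bounded_of_isTypeADEL [DecidableEq ι] (hX : X.IsSymm) (hX0 : ∀ i j, 0 ≤ X i j) (hind : IsIndecomposable X)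
    {G : Diagram} (hG : IsTypeADEL G) (hXG : IsAdjMatrixOf X G) (i j : ι) :
    ∃ C, ∀ k, |(f k X i j : ℝ)| ≤ C := by
  obtain ⟨δ, hδ⟩ := exists_isSubharmonic hG
  obtain ⟨e, he⟩ := hXG
  obtain ⟨a, h1, h2, ha⟩ := hδ.lt
  refine bounded_of_subharmonic hX hX0 hind (δ := fun i => δ ((e i : ℕ) + 1))
    (fun i => hδ.pos _ (by omega) (e i).isLt) (fun i => ?_)
    (i₀ := e.symm ⟨a - 1, by omega⟩) ?_ i j
  · rw [mulVec_of_isAdjMatrixOf hδ.inRange δ e he]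
    exact hδ.le _ (by omega) (e i).isLt
  · rw [mulVec_of_isAdjMatrixOf hδ.inRange δ e he]
    simpa [Nat.sub_add_cancel h1] using ha

end Consequences

/-! ### Extended diagrams inside a matrix -/

lemma isAdjMatrixOf_of_labelling {ι : Type*} {X : Matrix ι ι ℤ} {G : Diagram} (ρ : ℕ → ι)
    (hinj : ∀ a b, 1 ≤ a → a ≤ G.size → 1 ≤ b → b ≤ G.size → ρ a = ρ b → a = b)
    (hsurj : ∀ i, ∃ a, 1 ≤ a ∧ a ≤ G.size ∧ ρ a = i)
    (hentry : ∀ a b, 1 ≤ a → a ≤ G.size → 1 ≤ b → b ≤ G.size →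
      X (ρ a) (ρ b) = G.edges.count s(a, b)) :
    IsAdjMatrixOf X G := by
  let g : Fin G.size → ι := fun i => ρ ((i : ℕ) + 1)
  have hg : Function.Bijective g := by
    refine ⟨fun i j hij => Fin.ext ?_, fun i => ?_⟩
    · have := hinj _ _ (by omega) i.isLt (by omega) j.isLt hij
      omega
    · obtain ⟨a, h1, h2, rfl⟩ := hsurj i
      exact ⟨⟨a - 1, by omega⟩, by simp [g, Nat.sub_add_cancel h1]⟩
  refine ⟨(Equiv.ofBijective g hg).symm, ?_⟩
  ext i j
  obtain ⟨i, rfl⟩ := hg.2 i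
  obtain ⟨j, rfl⟩ := hg.2 j
  rw [submatrix_apply, Equiv.ofBijective_symm_apply_apply, Equiv.ofBijective_symm_apply_apply]
  exact hentry _ _ (by omega) i.isLt (by omega) j.isLt

section Embedding

variable {ι : Type*} [Fintype ι] {X : Matrix ι ι ℤ}

/-- If `2 - X` is positive semidefinite, a nonnegative vector with `2 v ≤ X v` satisfies
`X v = 2 v`: otherwise the form takes a negative value at `2 v + e i` for some `i`. -/
lemma mulVec_eq_of_le [DecidableEq ι] (hX : X.IsSymm) (hX0 : ∀ i j, 0 ≤ X i j)
    (hq : ∀ v : ι → ℤ, v ⬝ᵥ X *ᵥ v ≤ 2 * (v ⬝ᵥ v)) {v : ι → ℤ} (hv : ∀ i, 0 ≤ v i)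
    (h : ∀ i, 2 * v i ≤ (X *ᵥ v) i) (i : ι) : (X *ᵥ v) i = 2 * v i := by
  by_contra hne
  have hlt : 2 * v i < (X *ᵥ v) i := lt_of_le_of_ne (h i) (Ne.symm hne)
  have h1 := hq ((2 : ℤ) • v + Pi.single i 1)
  have h2 : 2 * (v ⬝ᵥ v) ≤ v ⬝ᵥ X *ᵥ v := by
    simp only [dotProduct, mul_sum]
    refine sum_le_sum fun j _ => ?_
    nlinarith [hv j, h j]
  have h3 : v ⬝ᵥ X *ᵥ Pi.single i 1 = (X *ᵥ v) i := by
    rw [dotProduct_mulVec, ← mulVec_transpose, hX.eq, dotProduct_single, mul_one]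
  have h4 : (X *ᵥ Pi.single i 1) i = X i i := by simp
  simp only [mulVec_add, mulVec_smul, dotProduct_add, add_dotProduct, dotProduct_smul,
    smul_dotProduct, smul_eq_mul, h3, single_dotProduct, dotProduct_single, h4,
    Pi.add_apply, Pi.smul_apply, Pi.single_eq_same] at h1
  linarith [hX0 i i]

/-- A nonzero nonnegative vector with `X v = 2 v` has full support. -/
lemma pos_of_mulVec_eq (hX : X.IsSymm) (hX0 : ∀ i j, 0 ≤ X i j) (hind : IsIndecomposable X)
    {v : ι → ℤ} (hv : ∀ i, 0 ≤ v i) (h : ∀ i, (X *ᵥ v) i = 2 * v i) {i₀ : ι} (h0 : 0 < v i₀)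
    (i : ι) : 0 < v i := by
  by_contra hi
  obtain ⟨a, ha, b, hb, hab⟩ := hind.2 {i | 0 < v i} ⟨i₀, h0⟩ ⟨i, hi⟩
  have hb0 : v b = 0 := le_antisymm (not_lt.mp hb) (hv b)
  have h1 := h b
  rw [hb0, mul_zero, mulVec, dotProduct, sum_eq_zero_iff_of_nonneg
    fun j _ => mul_nonneg (hX0 b j) (hv j)] at h1
  have h2 := h1 a (mem_univ a)
  rw [hX.apply a b, or_self] at hab
  rw [← hX.apply b a] at h2
  rcases mul_eq_zero.mp h2 with h3 | h3
  · exact hab h3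
  · exact (ne_of_gt ha) h3

/-- Rigidity of extended diagrams: if `2 - X` is positive semidefinite and a diagram `G` with a
harmonic function is contained in `X`, possibly with fewer edges, then `X` is the adjacency matrix
of `G`. -/
lemma isAdjMatrixOf_of_embedding [DecidableEq ι] (hX : X.IsSymm) (hX0 : ∀ i j, 0 ≤ X i j)
    (hind : IsIndecomposable X) (hq : ∀ v : ι → ℤ, v ⬝ᵥ X *ᵥ v ≤ 2 * (v ⬝ᵥ v))
    {G : Diagram} {δ : ℕ → ℤ} (hδ : G.IsHarmonic δ) (ρ : ℕ → ι)
    (hinj : ∀ a b, 1 ≤ a → a ≤ G.size → 1 ≤ b → b ≤ G.size → ρ a = ρ b → a = b)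
    (hle : ∀ a b, 1 ≤ a → a ≤ G.size → 1 ≤ b → b ≤ G.size →
      (G.edges.count s(a, b) : ℤ) ≤ X (ρ a) (ρ b)) :
    IsAdjMatrixOf X G := by
  let v : ι → ℤ := fun i => ∑ a ∈ Icc 1 G.size, if ρ a = i then δ a else 0
  have hv0 : ∀ i, 0 ≤ v i := fun i => sum_nonneg fun a ha => by
    rw [mem_Icc] at ha
    split_ifs
    · exact (hδ.pos a ha.1 ha.2).le
    · exact le_rfl
  have hvρ : ∀ a, 1 ≤ a → a ≤ G.size → v (ρ a) = δ a := by
    intro a h1 h2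
    have : ∀ b ∈ Icc 1 G.size, (if ρ b = ρ a then δ b else 0) = if b = a then δ a else 0 := by
      intro b hb
      rw [mem_Icc] at hb
      by_cases hba : b = a
      · simp [hba]
      · rw [if_neg hba, if_neg fun h => hba (hinj b a hb.1 hb.2 h1 h2 h)]
    simp only [v]
    rw [sum_congr rfl this]
    simp [h1, h2]
  have hXv : ∀ i, (X *ᵥ v) i = ∑ a ∈ Icc 1 G.size, X i (ρ a) * δ a := by
    intro i
    simp only [mulVec, dotProduct, v, mul_sum]
    rw [sum_comm]
    simp
  have hsum : ∀ a, 1 ≤ a → a ≤ G.size →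
      ∑ b ∈ Icc 1 G.size, (G.edges.count s(a, b) : ℤ) * δ b = 2 * δ a := by
    intro a h1 h2
    rw [sum_count_mul hδ.inRange, ← hδ.eq a h1 h2, Diagram.neighborSum]
  have hterm : ∀ a b, 1 ≤ a → a ≤ G.size → b ∈ Icc 1 G.size →
      (G.edges.count s(a, b) : ℤ) * δ b ≤ X (ρ a) (ρ b) * δ b := by
    intro a b h1 h2 hb
    rw [mem_Icc] at hb
    exact mul_le_mul_of_nonneg_right (hle a b h1 h2 hb.1 hb.2) (hδ.pos b hb.1 hb.2).le
  have hge : ∀ i, 2 * v i ≤ (X *ᵥ v) i := by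
    intro i
    by_cases hi : ∃ a, 1 ≤ a ∧ a ≤ G.size ∧ ρ a = i
    · obtain ⟨a, h1, h2, rfl⟩ := hi
      rw [hvρ a h1 h2, hXv, ← hsum a h1 h2]
      exact sum_le_sum fun b hb => hterm a b h1 h2 hb
    · have : v i = 0 := sum_eq_zero fun a ha => by
        rw [mem_Icc] at ha
        rw [if_neg fun h => hi ⟨a, ha.1, ha.2, h⟩]
      rw [this, mul_zero]
      exact sum_nonneg fun j _ => mul_nonneg (hX0 i j) (hv0 j)
  have heq := mulVec_eq_of_le hX hX0 hq hv0 hge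
  have hpos := pos_of_mulVec_eq hX hX0 hind hv0 heq (i₀ := ρ 1)
    (by rw [hvρ 1 le_rfl hδ.one_le_size]; exact hδ.pos 1 le_rfl hδ.one_le_size)
  have hsurj : ∀ i, ∃ a, 1 ≤ a ∧ a ≤ G.size ∧ ρ a = i := by
    intro i
    obtain ⟨a, ha, hne⟩ := exists_ne_zero_of_sum_ne_zero (hpos i).ne'
    rw [mem_Icc] at ha
    exact ⟨a, ha.1, ha.2, by by_contra h; exact hne (if_neg h)⟩
  have hentry : ∀ a b, 1 ≤ a → a ≤ G.size → 1 ≤ b → b ≤ G.size →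
      X (ρ a) (ρ b) = G.edges.count s(a, b) := by
    intro a b h1 h2 h3 h4
    have h5 := heq (ρ a)
    rw [hXv, hvρ a h1 h2, ← hsum a h1 h2, eq_comm,
      sum_eq_sum_iff_of_le fun b hb => hterm a b h1 h2 hb] at h5
    exact (mul_right_cancel₀ (hδ.pos b h3 h4).ne' (h5 b (mem_Icc.mpr ⟨h3, h4⟩))).symm
  exact isAdjMatrixOf_of_labelling ρ hinj hsurj hentry

end Embedding

/-- A symmetric indecomposable matrix with nonnegative integer entries such that `2 - X` is
positive semidefinite and which is not the adjacency matrix of an extended diagram. -/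
structure IsFiniteType {ι : Type*} [Fintype ι] (X : Matrix ι ι ℤ) : Prop where
  symm : X.IsSymm
  nonneg : ∀ i j, 0 ≤ X i j
  ind : IsIndecomposable X
  form_le : ∀ v : ι → ℤ, v ⬝ᵥ X *ᵥ v ≤ 2 * (v ⬝ᵥ v)
  not_tilde : ∀ G, IsTypeTilde G → ¬ IsAdjMatrixOf X G

/-- Distinct vertices joined by an edge. -/
def Adj {ι : Type*} (X : Matrix ι ι ℤ) (i j : ι) : Prop := i ≠ j ∧ X i j ≠ 0

/-- `ψ 0, …, ψ k` is a path: distinct vertices, each joined to the next one. -/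
def IsPath {ι : Type*} (X : Matrix ι ι ℤ) (k : ℕ) (ψ : ℕ → ι) : Prop :=
  (∀ a b, a ≤ k → b ≤ k → ψ a = ψ b → a = b) ∧ ∀ a < k, Adj X (ψ a) (ψ (a + 1))

/-- A vertex with at least three neighbours. -/
def IsBranch {ι : Type*} (X : Matrix ι ι ℤ) (v : ι) : Prop :=
  ∃ a b c, a ≠ b ∧ a ≠ c ∧ b ≠ c ∧ Adj X v a ∧ Adj X v b ∧ Adj X v c

lemma nodup_path (m n : ℕ) : (path m n).Nodup := by
  refine Multiset.Nodup.map (fun i j h => ?_) (Multiset.nodup_Ico)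
  simp only [Sym2.eq_iff] at h
  omega

namespace IsPath

variable {ι : Type*} {X : Matrix ι ι ℤ} {k : ℕ} {ψ : ℕ → ι}

lemma take (h : IsPath X k ψ) {l : ℕ} (hl : l ≤ k) : IsPath X l ψ :=
  ⟨fun a b ha hb => h.1 a b (ha.trans hl) (hb.trans hl), fun a ha => h.2 a (ha.trans_le hl)⟩

lemma snoc (h : IsPath X k ψ) {w : ι} (hw : ∀ j ≤ k, ψ j ≠ w) (hadj : Adj X (ψ k) w) :
    IsPath X (k + 1) (fun j => if j ≤ k then ψ j else w) := by
  constructor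
  · intro a b ha hb hab
    dsimp only at hab
    split_ifs at hab with h1 h2 h2
    · exact h.1 a b h1 h2 hab
    · exact absurd hab (hw a h1)
    · exact absurd hab.symm (hw b h2)
    · omega
  · intro a ha
    dsimp only
    rw [if_pos (by omega)]
    split_ifs with h1
    · exact h.2 a (by omega)
    · obtain rfl : a = k := by omega
      exact hadj

end IsPath

namespace IsFiniteType

variable {ι : Type*} [Fintype ι] {X : Matrix ι ι ℤ}

lemma adj_symm (h : IsFiniteType X) {i j : ι} (hij : Adj X i j) : Adj X j i :=
  ⟨hij.1.symm, by rw [h.symm.apply i j]; exact hij.2⟩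

lemma one_le_of_ne_zero (h : IsFiniteType X) {i j : ι} (hij : X i j ≠ 0) : 1 ≤ X i j :=
  lt_of_le_of_ne (h.nonneg i j) (Ne.symm hij)

lemma no_embedding_count (h : IsFiniteType X) {G : Diagram} (hG : IsTypeTilde G) (ρ : ℕ → ι)
    (hinj : ∀ a b, 1 ≤ a → a ≤ G.size → 1 ≤ b → b ≤ G.size → ρ a = ρ b → a = b)
    (hle : ∀ a b, 1 ≤ a → a ≤ G.size → 1 ≤ b → b ≤ G.size →
      (G.edges.count s(a, b) : ℤ) ≤ X (ρ a) (ρ b)) : False := by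
  classical
  obtain ⟨δ, hδ⟩ := exists_isHarmonic hG
  exact h.not_tilde G hG
    (isAdjMatrixOf_of_embedding h.symm h.nonneg h.ind h.form_le hδ ρ hinj hle)

/-- No extended diagram without multiple edges is contained in `X`. -/
lemma no_embedding (h : IsFiniteType X) {G : Diagram} (hG : IsTypeTilde G)
    (hnd : G.edges.Nodup) (ρ : ℕ → ι)
    (hinj : ∀ a b, 1 ≤ a → a ≤ G.size → 1 ≤ b → b ≤ G.size → ρ a = ρ b → a = b)
    (hE : ∀ e ∈ G.edges, ∃ a b, e = s(a, b) ∧ X (ρ a) (ρ b) ≠ 0) : False := by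
  refine h.no_embedding_count hG ρ hinj fun a b _ _ _ _ => ?_
  by_cases hab : s(a, b) ∈ G.edges
  · rw [Multiset.count_eq_one_of_mem hnd hab]
    obtain ⟨a', b', hs, hX⟩ := hE _ hab
    rcases Sym2.eq_iff.mp hs with ⟨rfl, rfl⟩ | ⟨rfl, rfl⟩
    · exact_mod_cast h.one_le_of_ne_zero hX
    · rw [h.symm.apply] at hX
      exact_mod_cast h.one_le_of_ne_zero hX
  · rw [Multiset.count_eq_zero_of_notMem hab]
    exact_mod_cast h.nonneg _ _

lemma diag_le_one (h : IsFiniteType X) (i : ι) : X i i ≤ 1 := by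
  by_contra! hi
  refine h.no_embedding_count (G := typeTildeL 1) (by right; right; right; left; exact ⟨1, le_rfl, rfl⟩) (fun _ => i)
    ?_ ?_
  · intro a b h1 h2 h3 h4 _
    simp only [typeTildeL] at h2 h4
    omega
  · intro a b h1 h2 h3 h4
    simp only [typeTildeL] at h2 h4
    obtain rfl : a = 1 := by omega
    obtain rfl : b = 1 := by omega
    have : (typeTildeL 1).edges.count s(1, 1) = 2 := by decide
    rw [this]
    exact_mod_cast hi

/-- There are no multiple edges, as `Ã₁` is excluded, and no multiple loops, as `L̃₁` is. -/
lemma le_one (h : IsFiniteType X) (i j : ι) : X i j ≤ 1 := by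
  by_cases hij : i = j
  · exact hij ▸ h.diag_le_one i
  by_contra! hX
  have hsz : (typeTildeA 1).size = 2 := rfl
  have c11 : (typeTildeA 1).edges.count s(1, 1) = 0 := by decide
  have c12 : (typeTildeA 1).edges.count s(1, 2) = 2 := by decide
  have c21 : (typeTildeA 1).edges.count s(2, 1) = 2 := by decide
  have c22 : (typeTildeA 1).edges.count s(2, 2) = 0 := by decide
  refine h.no_embedding_count (G := typeTildeA 1)
    (Or.inl ⟨1, le_rfl, rfl⟩) (fun a => if a = 1 then i else j) ?_ ?_
  · intro a b h1 h2 h3 h4 hab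
    rw [hsz] at h2 h4
    interval_cases a <;> interval_cases b <;> simp_all
  · intro a b h1 h2 h3 h4
    rw [hsz] at h2 h4
    have hX' : 2 ≤ X j i := by rw [h.symm.apply]; exact hX
    interval_cases a <;> interval_cases b
    · rw [c11]; exact_mod_cast h.nonneg _ _
    · rw [c12]; exact_mod_cast hX
    · rw [c21]; exact_mod_cast hX'
    · rw [c22]; exact_mod_cast h.nonneg _ _

/-- A cycle of at least three vertices is a diagram `Ãₖ`. -/
lemma no_cycle (h : IsFiniteType X) {k : ℕ} {ψ : ℕ → ι} (hψ : IsPath X k ψ) (hk : 2 ≤ k) :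
    ¬ Adj X (ψ k) (ψ 0) := by
  intro hadj
  refine h.no_embedding (G := typeTildeA k) (Or.inl ⟨k, by omega, rfl⟩) ?_
    (fun a => ψ (a - 1)) ?_ ?_
  · simp only [typeTildeA]
    rw [add_comm, Multiset.singleton_add, Multiset.nodup_cons]
    refine ⟨?_, nodup_path _ _⟩
    simp only [mem_path, Sym2.eq_iff]
    omega
  · intro a b h1 h2 h3 h4 hab
    simp only [typeTildeA] at h2 h4
    have := hψ.1 _ _ (by omega) (by omega) hab
    omega
  · intro e he
    simp only [typeTildeA, Multiset.mem_add, mem_path, Multiset.mem_singleton] at he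
    rcases he with ⟨i, h1, h2, rfl⟩ | rfl
    · refine ⟨_, _, rfl, ?_⟩
      have := (hψ.2 (i - 1) (by omega)).2
      rwa [show i - 1 + 1 = i + 1 - 1 by omega] at this
    · exact ⟨_, _, rfl, hadj.2⟩

lemma no_two_loops_on_path (h : IsFiniteType X) {k : ℕ} {ψ : ℕ → ι} (hψ : IsPath X k ψ)
    (hk : 1 ≤ k) (h0 : X (ψ 0) (ψ 0) ≠ 0) (h1 : X (ψ k) (ψ k) ≠ 0) : False := by
  refine h.no_embedding (G := typeTildeL (k + 1))
    (by right; right; right; left; exact ⟨k + 1, by omega, rfl⟩) ?_ (fun a => ψ (a - 1)) ?_ ?_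
  · simp only [typeTildeL]
    rw [add_comm, Multiset.singleton_add, Multiset.singleton_add, Multiset.nodup_cons,
      Multiset.nodup_cons, Multiset.mem_cons]
    refine ⟨?_, ?_, nodup_path _ _⟩ <;>
    · simp only [mem_path, Sym2.eq_iff]
      omega
  · intro a b h1 h2 h3 h4 hab
    simp only [typeTildeL] at h2 h4
    have := hψ.1 _ _ (by omega) (by omega) hab
    omega
  · intro e he
    simp only [typeTildeL, Multiset.mem_add, mem_path, Multiset.mem_singleton] at he
    rcases he with (rfl | ⟨i, h1, h2, rfl⟩) | rfl
    · exact ⟨_, _, rfl, h0⟩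
    · refine ⟨_, _, rfl, ?_⟩
      have := (hψ.2 (i - 1) (by omega)).2
      rwa [show i - 1 + 1 = i + 1 - 1 by omega] at this
    · exact ⟨_, _, rfl, h1⟩

/-- No path leads from a fork to a loop, as this is a diagram of type `D̃L`. -/
lemma no_fork_loop_on_path (h : IsFiniteType X) {k : ℕ} {ψ : ℕ → ι} (hψ : IsPath X k ψ)
    {a b : ι} (hab : a ≠ b) (ha : Adj X (ψ 0) a) (hb : Adj X (ψ 0) b) (ha' : ∀ j ≤ k, ψ j ≠ a)
    (hb' : ∀ j ≤ k, ψ j ≠ b) (hloop : X (ψ k) (ψ k) ≠ 0) : False := by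
  refine h.no_embedding (G := typeTildeDL (k + 3))
    (by right; right; right; right; exact ⟨k + 3, by omega, rfl⟩) ?_
    (fun j => if j = 1 then a else if j = 2 then b else ψ (j - 3)) ?_ ?_
  · simp only [typeTildeDL]
    rw [add_comm, Multiset.insert_eq_cons, Multiset.cons_add, Multiset.singleton_add,
      Multiset.singleton_add, Multiset.nodup_cons, Multiset.nodup_cons, Multiset.nodup_cons]
    refine ⟨?_, ?_, ?_, nodup_path _ _⟩ <;>
    · simp only [Multiset.mem_cons, mem_path, Sym2.eq_iff]
      omega
  · intro i j h1 h2 h3 h4 hij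
    simp only [typeTildeDL] at h2 h4
    split_ifs at hij
    all_goals first
      | omega
      | exact absurd hij hab
      | exact absurd hij.symm hab
      | exact absurd hij (ha' _ (by omega))
      | exact absurd hij.symm (ha' _ (by omega))
      | exact absurd hij (hb' _ (by omega))
      | exact absurd hij.symm (hb' _ (by omega))
      | (have := hψ.1 _ _ (by omega) (by omega) hij; omega)
  · intro e he
    simp only [typeTildeDL, Multiset.mem_add, mem_path, Multiset.mem_singleton,
      Multiset.insert_eq_cons, Multiset.mem_cons] at he
    rcases he with ((rfl | rfl) | ⟨i, h1, h2, rfl⟩) | rfl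
    · exact ⟨_, _, rfl, (h.adj_symm ha).2⟩
    · exact ⟨_, _, rfl, (h.adj_symm hb).2⟩
    · refine ⟨_, _, rfl, ?_⟩
      have := (hψ.2 (i - 3) (by omega)).2
      rw [show i - 3 + 1 = i + 1 - 3 by omega] at this
      rwa [if_neg (by omega), if_neg (by omega), if_neg (by omega), if_neg (by omega)]
    · exact ⟨_, _, rfl, by
        rwa [if_neg (by omega), if_neg (by omega), show k + 3 - 3 = k by omega]⟩

/-- No path leads from a fork to a fork, as this is a diagram of type `D̃`. -/
lemma no_two_forks_on_path (h : IsFiniteType X) {k : ℕ} {ψ : ℕ → ι} (hψ : IsPath X k ψ)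
    {a b c d : ι} (hab : a ≠ b) (hcd : c ≠ d) (hac : a ≠ c) (had : a ≠ d) (hbc : b ≠ c)
    (hbd : b ≠ d) (ha : Adj X (ψ 0) a) (hb : Adj X (ψ 0) b) (hc : Adj X (ψ k) c)
    (hd : Adj X (ψ k) d) (ha' : ∀ j ≤ k, ψ j ≠ a) (hb' : ∀ j ≤ k, ψ j ≠ b)
    (hc' : ∀ j ≤ k, ψ j ≠ c) (hd' : ∀ j ≤ k, ψ j ≠ d) : False := by
  refine h.no_embedding (G := typeTildeD (k + 4))
    (by right; left; exact ⟨k + 4, by omega, rfl⟩) ?_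
    (fun j => if j = 1 then a else if j = 2 then b else if j = k + 4 then c
      else if j = k + 5 then d else ψ (j - 3)) ?_ ?_
  · simp only [typeTildeD]
    rw [add_comm, Multiset.insert_eq_cons, Multiset.insert_eq_cons, Multiset.cons_add,
      Multiset.cons_add, Multiset.singleton_add, Multiset.singleton_add, Multiset.nodup_cons,
      Multiset.nodup_cons, Multiset.nodup_cons, Multiset.nodup_cons]
    refine ⟨?_, ?_, ?_, ?_, nodup_path _ _⟩ <;>
    · simp only [Multiset.mem_cons, mem_path, Sym2.eq_iff]
      omega
  · intro i j h1 h2 h3 h4 hij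
    simp only [typeTildeD] at h2 h4
    split_ifs at hij
    all_goals first
      | omega
      | exact absurd hij (by assumption)
      | exact absurd hij.symm (by assumption)
      | exact absurd hij (ha' _ (by omega))
      | exact absurd hij.symm (ha' _ (by omega))
      | exact absurd hij (hb' _ (by omega))
      | exact absurd hij.symm (hb' _ (by omega))
      | exact absurd hij (hc' _ (by omega))
      | exact absurd hij.symm (hc' _ (by omega))
      | exact absurd hij (hd' _ (by omega))
      | exact absurd hij.symm (hd' _ (by omega))
      | (have := hψ.1 _ _ (by omega) (by omega) hij; omega)
  · intro e he
    have hend : ∀ x, Adj X (ψ k) x → X (if k + 4 - 1 = 1 then a else if k + 4 - 1 = 2 then b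
        else if k + 4 - 1 = k + 4 then c else if k + 4 - 1 = k + 5 then d
        else ψ (k + 4 - 1 - 3)) x ≠ 0 := by
      intro x hx
      rw [if_neg (by omega), if_neg (by omega), if_neg (by omega), if_neg (by omega),
        show k + 4 - 1 - 3 = k by omega]
      exact hx.2
    simp only [typeTildeD, Multiset.mem_add, mem_path, Multiset.mem_singleton,
      Multiset.insert_eq_cons, Multiset.mem_cons] at he
    rcases he with ((rfl | rfl) | ⟨i, h1, h2, rfl⟩) | rfl | rfl
    · exact ⟨_, _, rfl, by simpa using (h.adj_symm ha).2⟩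
    · exact ⟨_, _, rfl, by simpa using (h.adj_symm hb).2⟩
    · refine ⟨_, _, rfl, ?_⟩
      have := (hψ.2 (i - 3) (by omega)).2
      rw [show i - 3 + 1 = i + 1 - 3 by omega] at this
      rwa [if_neg (by omega), if_neg (by omega), if_neg (by omega), if_neg (by omega),
        if_neg (by omega), if_neg (by omega), if_neg (by omega), if_neg (by omega)]
    · exact ⟨_, _, rfl, by simpa using hend c hc⟩
    · exact ⟨_, _, rfl, by simpa using hend d hd⟩

lemma isPath_reverse (h : IsFiniteType X) {k : ℕ} {ψ : ℕ → ι} (hψ : IsPath X k ψ) :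
    IsPath X k (fun j => ψ (k - j)) := by
  constructor
  · intro a b ha hb hab
    have := hψ.1 _ _ (by omega) (by omega) hab
    omega
  · intro a ha
    have := hψ.2 (k - (a + 1)) (by omega)
    rw [show k - (a + 1) + 1 = k - a by omega] at this
    exact h.adj_symm this

lemma exists_path (h : IsFiniteType X) (u v : ι) :
    ∃ k ψ, IsPath X k ψ ∧ ψ 0 = u ∧ ψ k = v := by
  by_contra hv
  obtain ⟨a, ⟨k, ψ, hψ, h0, rfl⟩, b, hb, hab⟩ :=
    h.ind.2 {v | ∃ k ψ, IsPath X k ψ ∧ ψ 0 = u ∧ ψ k = v}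
      ⟨u, 0, fun _ => u, ⟨fun a b ha hb _ => by omega, fun a ha => by omega⟩, rfl, rfl⟩ ⟨v, hv⟩
  rw [h.symm.apply (ψ k) b, or_self] at hab
  by_cases hmem : ∃ j ≤ k, ψ j = b
  · obtain ⟨j, hj, rfl⟩ := hmem
    exact hb ⟨j, ψ, hψ.take hj, h0, rfl⟩
  · push Not at hmem
    exact hb ⟨k + 1, _, hψ.snoc hmem ⟨hmem k le_rfl, hab⟩, by simpa using h0, by simp⟩

/-- A neighbour of the start of a path which is not its second vertex is not on the path. -/
lemma ne_of_adj_start (h : IsFiniteType X) {k : ℕ} {ψ : ℕ → ι} (hψ : IsPath X k ψ) {a : ι}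
    (ha : Adj X (ψ 0) a) (ha1 : a ≠ ψ 1) : ∀ j ≤ k, ψ j ≠ a := by
  rintro j hj rfl
  rcases Nat.lt_or_ge j 2 with hj2 | hj2
  · interval_cases j
    · exact ha.1 rfl
    · exact ha1 rfl
  · exact h.no_cycle (hψ.take hj) hj2 (h.adj_symm ha)

/-- A common neighbour of both ends of a path would close a cycle. -/
lemma ne_of_adj_ends (h : IsFiniteType X) {k : ℕ} {ψ : ℕ → ι} (hψ : IsPath X k ψ) (hk : 1 ≤ k)
    {a c : ι} (ha : Adj X (ψ 0) a) (hc : Adj X (ψ k) c) (hc' : ∀ j ≤ k, ψ j ≠ c) : a ≠ c := by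
  rintro rfl
  refine h.no_cycle (hψ.snoc hc' hc) (by omega) ?_
  simpa using h.adj_symm ha

end IsFiniteType

lemma IsBranch.exists_pair {ι : Type*} {X : Matrix ι ι ℤ} {v : ι} (hv : IsBranch X v) (x : ι) :
    ∃ a b, a ≠ b ∧ a ≠ x ∧ b ≠ x ∧ Adj X v a ∧ Adj X v b := by
  obtain ⟨a, b, c, hab, hac, hbc, ha, hb, hc⟩ := hv
  by_cases h1 : a = x
  · exact ⟨b, c, hbc, h1 ▸ hab.symm, h1 ▸ hac.symm, hb, hc⟩
  · by_cases h2 : b = x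
    · exact ⟨a, c, hac, h1, h2 ▸ hbc.symm, ha, hc⟩
    · exact ⟨a, b, hab, h1, h2, ha, hb⟩

namespace IsFiniteType

variable {ι : Type*} [Fintype ι] {X : Matrix ι ι ℤ}

lemma loop_unique (h : IsFiniteType X) {u v : ι} (hu : X u u ≠ 0) (hv : X v v ≠ 0) : u = v := by
  obtain ⟨k, ψ, hψ, rfl, rfl⟩ := h.exists_path u v
  rcases Nat.eq_zero_or_pos k with rfl | hk
  · rfl
  · exact (h.no_two_loops_on_path hψ hk hu hv).elim

lemma not_isBranch_of_loop (h : IsFiniteType X) {u : ι} (hu : X u u ≠ 0) (v : ι) :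
    ¬ IsBranch X v := by
  intro hv
  obtain ⟨k, ψ, hψ, rfl, rfl⟩ := h.exists_path v u
  obtain ⟨a, b, hab, ha1, hb1, ha, hb⟩ := hv.exists_pair (ψ 1)
  exact h.no_fork_loop_on_path hψ hab ha hb (h.ne_of_adj_start hψ ha ha1)
    (h.ne_of_adj_start hψ hb hb1) hu

lemma branch_unique (h : IsFiniteType X) {u v : ι} (hu : IsBranch X u) (hv : IsBranch X v) :
    u = v := by
  obtain ⟨k, ψ, hψ, rfl, rfl⟩ := h.exists_path u v
  rcases Nat.eq_zero_or_pos k with rfl | hk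
  · rfl
  exfalso
  obtain ⟨a, b, hab, ha1, hb1, ha, hb⟩ := hu.exists_pair (ψ 1)
  obtain ⟨c, d, hcd, hc1, hd1, hc, hd⟩ := hv.exists_pair (ψ (k - 1))
  have hrev := h.isPath_reverse hψ
  have hoff : ∀ x, Adj X (ψ k) x → x ≠ ψ (k - 1) → ∀ j ≤ k, ψ j ≠ x := by
    intro x hx hx1 j hj
    have := h.ne_of_adj_start hrev hx hx1 (k - j) (by omega)
    simpa [show k - (k - j) = j by omega] using this
  have hc' := hoff c hc hc1
  have hd' := hoff d hd hd1
  exact h.no_two_forks_on_path hψ hab hcd (h.ne_of_adj_ends hψ hk ha hc hc')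
    (h.ne_of_adj_ends hψ hk ha hd hd') (h.ne_of_adj_ends hψ hk hb hc hc')
    (h.ne_of_adj_ends hψ hk hb hd hd') ha hb hc hd (h.ne_of_adj_start hψ ha ha1)
    (h.ne_of_adj_start hψ hb hb1) hc' hd'

/-- Four neighbours of one vertex form a diagram `D̃₄`. -/
lemma no_four_neighbors (h : IsFiniteType X) {v a b c d : ι} (hab : a ≠ b) (hac : a ≠ c)
    (had : a ≠ d) (hbc : b ≠ c) (hbd : b ≠ d) (hcd : c ≠ d) (ha : Adj X v a) (hb : Adj X v b)
    (hc : Adj X v c) (hd : Adj X v d) : False :=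
  h.no_two_forks_on_path (k := 0) (ψ := fun _ => v)
    ⟨fun a b ha hb _ => by omega, fun a ha => by omega⟩ hab hcd hac had hbc hbd ha hb hc hd
    (fun _ _ => ha.1) (fun _ _ => hb.1) (fun _ _ => hc.1) (fun _ _ => hd.1)

/-- Two neighbours of a vertex with a loop form a diagram `D̃L₃`. -/
lemma neighbor_unique_of_loop (h : IsFiniteType X) {v a b : ι} (hv : X v v ≠ 0)
    (ha : Adj X v a) (hb : Adj X v b) : a = b := by
  by_contra hab
  exact h.no_fork_loop_on_path (k := 0) (ψ := fun _ => v)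
    ⟨fun a b ha hb _ => by omega, fun a ha => by omega⟩ hab ha hb
    (fun _ _ => ha.1) (fun _ _ => hb.1) hv

end IsFiniteType

/-! ### Spiders -/

/-- `ψ a 0, …, ψ a (ℓ a)` (`a = 0, 1, 2`) are three paths which start at the vertex `c` and have no
other vertex in common. The lengths `ℓ a` may be zero. -/
structure IsSpider {ι : Type*} (X : Matrix ι ι ℤ) (c : ι) (ℓ : Fin 3 → ℕ) (ψ : Fin 3 → ℕ → ι) :
    Prop where
  root : ∀ a, ψ a 0 = c
  inj : ∀ a b k l, k ≤ ℓ a → l ≤ ℓ b → ψ a k = ψ b l → k = l ∧ (a = b ∨ k = 0)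
  adj : ∀ a k, k < ℓ a → Adj X (ψ a k) (ψ a (k + 1))

/-- Adjacency of the vertices `(a, k)`, `(b, l)` of a spider, `k` and `l` being the distances from
the centre. -/
def SpiderAdj (a b : Fin 3) (k l : ℕ) : Prop :=
  (a = b ∨ k = 0 ∨ l = 0) ∧ (l = k + 1 ∨ k = l + 1)

instance (a b : Fin 3) (k l : ℕ) : Decidable (SpiderAdj a b k l) :=
  inferInstanceAs (Decidable (_ ∧ _))

namespace IsSpider

variable {ι : Type*} {X : Matrix ι ι ℤ} {c : ι} {ℓ : Fin 3 → ℕ} {ψ : Fin 3 → ℕ → ι}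

lemma perm (hs : IsSpider X c ℓ ψ) (σ : Equiv.Perm (Fin 3)) :
    IsSpider X c (ℓ ∘ σ) (ψ ∘ σ) := by
  refine ⟨fun a => hs.root _, fun a b k l hk hl h => ?_, fun a k hk => hs.adj _ _ hk⟩
  obtain ⟨h1, h2⟩ := hs.inj _ _ _ _ hk hl h
  exact ⟨h1, h2.imp_left fun h => σ.injective h⟩

lemma extend (hs : IsSpider X c ℓ ψ) (a : Fin 3) {w : ι} (hw : ∀ b, ∀ k ≤ ℓ b, ψ b k ≠ w)
    (hadj : Adj X (ψ a (ℓ a)) w) : ∃ ℓ' ψ', IsSpider X c ℓ' ψ' ∧ ∑ b, ℓ b < ∑ b, ℓ' b := by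
  refine ⟨fun b => if b = a then ℓ a + 1 else ℓ b,
    fun b k => if b = a ∧ k = ℓ a + 1 then w else ψ b k, ⟨fun b => ?_, ?_, ?_⟩, ?_⟩
  · rw [if_neg (by omega), hs.root]
  · intro b d k l hk hl h
    by_cases h1 : b = a ∧ k = ℓ a + 1 <;> by_cases h2 : d = a ∧ l = ℓ a + 1
    · exact ⟨h1.2.trans h2.2.symm, Or.inl (h1.1.trans h2.1.symm)⟩
    · rw [if_pos h1, if_neg h2] at h
      refine absurd h.symm (hw d l ?_)
      split_ifs at hl with h3
      · subst h3; simp only [true_and] at h2; omega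
      · exact hl
    · rw [if_neg h1, if_pos h2] at h
      refine absurd h (hw b k ?_)
      split_ifs at hk with h3
      · subst h3; simp only [true_and] at h1; omega
      · exact hk
    · rw [if_neg h1, if_neg h2] at h
      refine hs.inj b d k l ?_ ?_ h
      · split_ifs at hk with h3
        · subst h3; simp only [true_and] at h1; omega
        · exact hk
      · split_ifs at hl with h3
        · subst h3; simp only [true_and] at h2; omega
        · exact hl
  · intro b k hk
    by_cases hb : b = a
    · subst hb
      rw [if_pos rfl] at hk
      rw [if_neg (by omega)]
      by_cases hk' : k = ℓ b
      · subst hk'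
        rw [if_pos ⟨rfl, rfl⟩]
        exact hadj
      · rw [if_neg (by omega)]
        exact hs.adj b k (by omega)
    · rw [if_neg hb] at hk
      rw [if_neg (by tauto), if_neg (by tauto)]
      exact hs.adj b k hk
  · refine sum_lt_sum (fun b _ => ?_) ⟨a, mem_univ a, by simp⟩
    split_ifs with hb
    · subst hb; omega
    · exact le_rfl

lemma isPath_arm (hs : IsSpider X c ℓ ψ) (a : Fin 3) : IsPath X (ℓ a) (ψ a) :=
  ⟨fun k l hk hl h => (hs.inj a a k l hk hl h).1, fun k hk => hs.adj a k hk⟩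

lemma card_bound [Fintype ι] (hs : IsSpider X c ℓ ψ) : ∑ a, ℓ a ≤ 3 * Fintype.card ι := by
  have : ∀ a, ℓ a ≤ Fintype.card ι := by
    intro a
    have := Fintype.card_le_of_injective (fun k : Fin (ℓ a + 1) => ψ a k) fun k l h =>
      Fin.ext ((hs.isPath_arm a).1 k l (by omega) (by omega) h)
    rw [Fintype.card_fin] at this
    omega
  calc ∑ a, ℓ a ≤ ∑ _a : Fin 3, Fintype.card ι := sum_le_sum fun a _ => this a
    _ = 3 * Fintype.card ι := by simp

end IsSpider

namespace IsFiniteType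

variable {ι : Type*} [Fintype ι] {X : Matrix ι ι ℤ} {c : ι} {ℓ : Fin 3 → ℕ} {ψ : Fin 3 → ℕ → ι}

lemma exists_maximal_spider (X : Matrix ι ι ℤ) (c : ι) :
    ∃ ℓ ψ, IsSpider X c ℓ ψ ∧ ∀ ℓ' ψ', IsSpider X c ℓ' ψ' → ∑ a, ℓ' a ≤ ∑ a, ℓ a := by
  let S : Set ℕ := {s | ∃ ℓ ψ, IsSpider X c ℓ ψ ∧ ∑ a, ℓ a = s}
  have hne : S.Nonempty := ⟨0, fun _ => 0, fun _ _ => c,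
    ⟨fun _ => rfl, fun a b k l hk hl _ => ⟨by omega, Or.inr (by omega)⟩,
      fun a k hk => absurd hk (by omega)⟩, by simp⟩
  have hbdd : BddAbove S := ⟨3 * Fintype.card ι, by
    rintro s ⟨ℓ, ψ, hs, rfl⟩
    exact hs.card_bound⟩
  obtain ⟨ℓ, ψ, hs, hsum⟩ := Nat.sSup_mem hne hbdd
  refine ⟨ℓ, ψ, hs, fun ℓ' ψ' hs' => ?_⟩
  rw [hsum]
  exact le_csSup hbdd ⟨ℓ', ψ', hs', rfl⟩

/-- If no vertex other than `c` is a branch vertex, a maximal spider with centre `c` contains every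
vertex. -/
lemma exists_spanning_spider (h : IsFiniteType X) (hc : ∀ v, IsBranch X v → v = c) :
    ∃ ℓ ψ, IsSpider X c ℓ ψ ∧ ∀ v, ∃ a, ∃ k ≤ ℓ a, ψ a k = v := by
  obtain ⟨ℓ, ψ, hs, hmax⟩ := exists_maximal_spider X c
  refine ⟨ℓ, ψ, hs, fun v => ?_⟩
  by_contra hv
  obtain ⟨_, ⟨a, k, hk, rfl⟩, w, hw, haw⟩ :=
    h.ind.2 {v | ∃ a, ∃ k ≤ ℓ a, ψ a k = v} ⟨c, 0, 0, Nat.zero_le _, hs.root 0⟩ ⟨v, hv⟩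
  have hw' : ∀ b, ∀ k ≤ ℓ b, ψ b k ≠ w := fun b k hk hbk => hw ⟨b, k, hk, hbk⟩
  rw [h.symm.apply (ψ a k) w, or_self] at haw
  have hadj : Adj X (ψ a k) w := ⟨hw' a k hk, haw⟩
  have hext : ∀ b, ¬ Adj X (ψ b (ℓ b)) w := by
    intro b hb
    obtain ⟨ℓ', ψ', hs', hlt⟩ := hs.extend b hw' hb
    exact absurd (hmax ℓ' ψ' hs') (by omega)
  rcases Nat.lt_or_ge k (ℓ a) with hk1 | hk1
  · rcases Nat.eq_zero_or_pos k with rfl | hk0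
    · rw [hs.root] at hadj
      have hpos : ∀ b, 1 ≤ ℓ b := by
        intro b
        by_contra hb
        have hb0 : ℓ b = 0 := by omega
        exact hext b (by rw [hb0, hs.root]; exact hadj)
      have hnb : ∀ b, Adj X c (ψ b 1) := fun b => by
        have := hs.adj b 0 (hpos b)
        rwa [hs.root] at this
      have hne : ∀ b d, b ≠ d → ψ b 1 ≠ ψ d 1 := by
        intro b d hbd heq
        rcases (hs.inj b d 1 1 (hpos b) (hpos d) heq).2 with h1 | h1
        · exact hbd h1
        · omega
      exact h.no_four_neighbors (hne 0 1 (by decide)) (hne 0 2 (by decide)) (hw' 0 1 (hpos 0))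
        (hne 1 2 (by decide)) (hw' 1 1 (hpos 1)) (hw' 2 1 (hpos 2)) (hnb 0) (hnb 1) (hnb 2) hadj
    · have hprev : Adj X (ψ a (k - 1)) (ψ a k) := by
        have := hs.adj a (k - 1) (by omega)
        rwa [Nat.sub_add_cancel hk0] at this
      have hbr := hc (ψ a k) ⟨ψ a (k - 1), ψ a (k + 1), w, fun heq => by
          have := (hs.isPath_arm a).1 _ _ (by omega) (by omega) heq
          omega,
        hw' _ _ (by omega), hw' _ _ (by omega), h.adj_symm hprev, hs.adj a k hk1, hadj⟩
      rw [← hs.root a] at hbr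
      have := (hs.isPath_arm a).1 _ _ hk (Nat.zero_le _) hbr
      omega
  · obtain rfl : k = ℓ a := le_antisymm hk hk1
    exact hext a hadj

/-- The only edges between vertices of a spider are those of the spider; any other would close a
cycle. -/
lemma spider_adj_iff (h : IsFiniteType X) (hs : IsSpider X c ℓ ψ) {a b : Fin 3} {k l : ℕ}
    (hk : k ≤ ℓ a) (hl : l ≤ ℓ b) : Adj X (ψ a k) (ψ b l) ↔ SpiderAdj a b k l := by
  constructor
  · intro hadj
    by_cases hab : a = b
    · subst hab
      have key : ∀ k l, k ≤ l → l ≤ ℓ a → Adj X (ψ a l) (ψ a k) → l = k + 1 := by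
        intro k l hkl hl hadj
        have hne : l ≠ k := by
          rintro rfl
          exact hadj.1 rfl
        by_contra hne'
        refine h.no_cycle (k := l - k) (ψ := fun j => ψ a (k + j)) ⟨fun i j hi hj hij => ?_,
          fun j hj => hs.adj a (k + j) (by omega)⟩ (by omega) ?_
        · have := (hs.isPath_arm a).1 _ _ (by omega) (by omega) hij
          omega
        · simpa [Nat.add_sub_cancel' hkl] using hadj
      refine ⟨Or.inl rfl, ?_⟩
      rcases le_total k l with hkl | hkl
      · exact Or.inl (key k l hkl hl (h.adj_symm hadj))
      · exact Or.inr (key l k hkl hk hadj)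
    · have hpath : IsPath X (k + l) (fun j => if j ≤ k then ψ a (k - j) else ψ b (j - k)) := by
        constructor
        · intro i j hi hj hij
          dsimp only at hij
          split_ifs at hij with h1 h2 h2
          · have := (hs.isPath_arm a).1 _ _ (by omega) (by omega) hij
            omega
          · have := hs.inj a b _ _ (by omega) (by omega) hij
            omega
          · have := hs.inj b a _ _ (by omega) (by omega) hij
            omega
          · have := (hs.isPath_arm b).1 _ _ (by omega) (by omega) hij
            omega
        · intro j hj
          dsimp only
          by_cases h1 : j + 1 ≤ k
          · rw [if_pos (by omega), if_pos h1]
            have := hs.adj a (k - (j + 1)) (by omega)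
            rw [show k - (j + 1) + 1 = k - j by omega] at this
            exact h.adj_symm this
          · rw [if_neg h1]
            by_cases h2 : j ≤ k
            · obtain rfl : j = k := by omega
              rw [if_pos le_rfl, Nat.sub_self, hs.root a, ← hs.root b,
                show j + 1 - j = 0 + 1 by omega]
              exact hs.adj b 0 (by omega)
            · rw [if_neg h2, show j + 1 - k = j - k + 1 by omega]
              exact hs.adj b (j - k) (by omega)
      have hend : (if k + l ≤ k then ψ a (k - (k + l)) else ψ b (k + l - k)) = ψ b l := by
        split_ifs with h1
        · obtain rfl : l = 0 := by omega
          simp [hs.root]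
        · rw [Nat.add_sub_cancel_left]
      have hlt : k + l < 2 := by
        by_contra hge
        refine h.no_cycle hpath (by omega) ?_
        rw [hend, if_pos (Nat.zero_le _), Nat.sub_zero]
        exact h.adj_symm hadj
      have hne : ¬ (k = 0 ∧ l = 0) := by
        rintro ⟨rfl, rfl⟩
        exact hadj.1 (by rw [hs.root, hs.root])
      exact ⟨Or.inr (by omega), by omega⟩
  · rintro ⟨h1, h2⟩
    have key : ∀ a b k l, k ≤ ℓ a → l ≤ ℓ b → (a = b ∨ k = 0 ∨ l = 0) → l = k + 1 →
        Adj X (ψ a k) (ψ b l) := by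
      rintro a b k l hk hl h1 rfl
      have : ψ a k = ψ b k := by
        rcases h1 with rfl | rfl | h1
        · rfl
        · rw [hs.root, hs.root]
        · omega
      rw [this]
      exact hs.adj b k hl
    rcases h2 with h2 | h2
    · exact key a b k l hk hl h1 h2
    · exact h.adj_symm (key b a l k hl hk (by tauto) h2)

/-- No extended diagram is contained in a spider. In the embedding, `α a` and `κ a` are the arm and
the distance from the centre of the vertex with the label `a`. -/
lemma no_embedding_spider (h : IsFiniteType X) (hs : IsSpider X c ℓ ψ) {G : Diagram}
    (hG : IsTypeTilde G) (hnd : G.edges.Nodup) (α : ℕ → Fin 3) (κ : ℕ → ℕ)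
    (hκ : ∀ a, 1 ≤ a → a ≤ G.size → κ a ≤ ℓ (α a))
    (hinj : ∀ a b, 1 ≤ a → a ≤ G.size → 1 ≤ b → b ≤ G.size → κ a = κ b →
      (α a = α b ∨ κ a = 0) → a = b)
    (hE : ∀ a b, 1 ≤ a → a ≤ G.size → 1 ≤ b → b ≤ G.size → s(a, b) ∈ G.edges →
      SpiderAdj (α a) (α b) (κ a) (κ b)) : False := by
  obtain ⟨δ, hδ⟩ := exists_isHarmonic hG
  refine h.no_embedding hG hnd (fun a => ψ (α a) (κ a)) ?_ ?_
  · intro a b h1 h2 h3 h4 hab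
    obtain ⟨h5, h6⟩ := hs.inj _ _ _ _ (hκ a h1 h2) (hκ b h3 h4) hab
    exact hinj a b h1 h2 h3 h4 h5 h6
  · intro e he
    induction e with
    | _ a b =>
      obtain ⟨h1, h2⟩ := hδ.inRange _ he a (Sym2.mem_mk_left a b)
      obtain ⟨h3, h4⟩ := hδ.inRange _ he b (Sym2.mem_mk_right a b)
      exact ⟨a, b, rfl, ((h.spider_adj_iff hs (hκ a h1 h2) (hκ b h3 h4)).mpr
        (hE a b h1 h2 h3 h4 he)).2⟩

/-- If `X` is spanned by a spider whose edges are those of `G` in the labelling `a ↦ (α a, κ a)`,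
then `X` is the adjacency matrix of `G`. -/
lemma isAdjMatrixOf_of_spider (h : IsFiniteType X) (hs : IsSpider X c ℓ ψ)
    (hsurj : ∀ v, ∃ a, ∃ k ≤ ℓ a, ψ a k = v) {G : Diagram}
    (hnd : G.edges.Nodup) (α : ℕ → Fin 3) (κ : ℕ → ℕ)
    (hκ : ∀ a, 1 ≤ a → a ≤ G.size → κ a ≤ ℓ (α a))
    (hinj : ∀ a b, 1 ≤ a → a ≤ G.size → 1 ≤ b → b ≤ G.size → κ a = κ b →
      (α a = α b ∨ κ a = 0) → a = b)
    (hcov : ∀ x, ∀ k ≤ ℓ x, ∃ a, 1 ≤ a ∧ a ≤ G.size ∧ κ a = k ∧ (α a = x ∨ k = 0))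
    (hE : ∀ a b, 1 ≤ a → a ≤ G.size → 1 ≤ b → b ≤ G.size → a ≠ b →
      (s(a, b) ∈ G.edges ↔ SpiderAdj (α a) (α b) (κ a) (κ b)))
    (hloop : ∀ a, 1 ≤ a → a ≤ G.size →
      (s(a, a) ∈ G.edges ↔ X (ψ (α a) (κ a)) (ψ (α a) (κ a)) ≠ 0)) :
    IsAdjMatrixOf X G := by
  let ρ : ℕ → ι := fun a => ψ (α a) (κ a)
  have hρ : ∀ a b, 1 ≤ a → a ≤ G.size → 1 ≤ b → b ≤ G.size → ρ a = ρ b → a = b := by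
    intro a b h1 h2 h3 h4 hab
    obtain ⟨h5, h6⟩ := hs.inj _ _ _ _ (hκ a h1 h2) (hκ b h3 h4) hab
    exact hinj a b h1 h2 h3 h4 h5 h6
  have hmem : ∀ a b, 1 ≤ a → a ≤ G.size → 1 ≤ b → b ≤ G.size →
      (s(a, b) ∈ G.edges ↔ X (ρ a) (ρ b) ≠ 0) := by
    intro a b h1 h2 h3 h4
    by_cases hab : a = b
    · subst hab
      exact hloop a h1 h2
    · rw [hE a b h1 h2 h3 h4 hab, ← h.spider_adj_iff hs (hκ a h1 h2) (hκ b h3 h4)]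
      exact ⟨fun hadj => hadj.2, fun hX => ⟨fun heq => hab (hρ a b h1 h2 h3 h4 heq), hX⟩⟩
  have hentry : ∀ a b, 1 ≤ a → a ≤ G.size → 1 ≤ b → b ≤ G.size →
      X (ρ a) (ρ b) = G.edges.count s(a, b) := by
    intro a b h1 h2 h3 h4
    by_cases hab : s(a, b) ∈ G.edges
    · rw [Multiset.count_eq_one_of_mem hnd hab]
      exact_mod_cast le_antisymm (h.le_one _ _)
        (h.one_le_of_ne_zero ((hmem a b h1 h2 h3 h4).mp hab))
    · rw [Multiset.count_eq_zero_of_notMem hab]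
      by_contra hX
      exact hab ((hmem a b h1 h2 h3 h4).mpr (by exact_mod_cast hX))
  refine isAdjMatrixOf_of_labelling ρ hρ (fun i => ?_) hentry
  obtain ⟨x, k, hk, rfl⟩ := hsurj i
  obtain ⟨a, h1, h2, rfl, h3⟩ := hcov x k hk
  refine ⟨a, h1, h2, ?_⟩
  rcases h3 with rfl | h3
  · rfl
  · simp only [ρ, h3, hs.root]

end IsFiniteType

/-! ### Identification of the diagram -/

lemma mk_mem_path {a b m n : ℕ} :
    s(a, b) ∈ path m n ↔ (m ≤ a ∧ a < n ∧ b = a + 1) ∨ (m ≤ b ∧ b < n ∧ a = b + 1) := by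
  simp only [mem_path, Sym2.eq_iff]
  constructor
  · rintro ⟨i, h1, h2, ⟨rfl, rfl⟩ | ⟨rfl, rfl⟩⟩ <;> omega
  · rintro (⟨h1, h2, rfl⟩ | ⟨h1, h2, rfl⟩)
    · exact ⟨a, h1, h2, Or.inl ⟨rfl, rfl⟩⟩
    · exact ⟨b, h1, h2, Or.inr ⟨rfl, rfl⟩⟩

namespace IsFiniteType

variable {ι : Type*} [Fintype ι] {X : Matrix ι ι ℤ} {c : ι} {ℓ : Fin 3 → ℕ} {ψ : Fin 3 → ℕ → ι}

section Identification

variable (h : IsFiniteType X) (hs : IsSpider X c ℓ ψ) (hsurj : ∀ v, ∃ a, ∃ k ≤ ℓ a, ψ a k = v)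
include h hs hsurj

/-- With two arms, the labels run through one arm towards the centre and on through the other. -/
lemma isAdjMatrixOf_typeA (hloop : ∀ v, X v v = 0) (h0 : ℓ 0 = 0) :
    IsAdjMatrixOf X (typeA (ℓ 1 + ℓ 2 + 1)) := by
  refine h.isAdjMatrixOf_of_spider hs hsurj (nodup_path _ _)
    (fun a => if a ≤ ℓ 1 then 1 else 2)
    (fun a => if a ≤ ℓ 1 then ℓ 1 + 1 - a else a - 1 - ℓ 1) ?_ ?_ ?_ ?_ ?_
  · intro a h1 h2
    simp only [typeA] at h2
    split_ifs <;> omega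
  · intro a b h1 h2 h3 h4 h5 h6
    simp only [typeA] at h2 h4
    by_cases ha : a ≤ ℓ 1 <;> by_cases hb : b ≤ ℓ 1 <;> simp [ha, hb] at h5 h6 <;> omega
  · intro x k hk
    simp only [typeA]
    fin_cases x
    · refine ⟨ℓ 1 + 1, by omega, by omega, ?_⟩
      have hk' : k ≤ ℓ 0 := hk
      simp; omega
    · have hk' : k ≤ ℓ 1 := hk
      refine ⟨ℓ 1 + 1 - k, by omega, by omega, ?_⟩
      by_cases hk0 : k = 0
      · simp [hk0]
      · rw [if_pos (by omega), if_pos (by omega)]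
        exact ⟨by omega, Or.inl rfl⟩
    · have hk' : k ≤ ℓ 2 := hk
      refine ⟨ℓ 1 + 1 + k, by omega, by omega, ?_⟩
      rw [if_neg (by omega), if_neg (by omega)]
      exact ⟨by omega, Or.inl rfl⟩
  · intro a b h1 h2 h3 h4 hab
    simp only [typeA] at h2 h4
    simp only [typeA, mk_mem_path, SpiderAdj]
    by_cases ha : a ≤ ℓ 1 <;> by_cases hb : b ≤ ℓ 1 <;> simp [ha, hb] <;> omega
  · intro a h1 h2
    simp only [hloop, typeA, mk_mem_path]
    omega

lemma isAdjMatrixOf_typeL (hc : X c c ≠ 0) (h0 : ℓ 0 = 0) (h1 : ℓ 1 = 0) :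
    IsAdjMatrixOf X (typeL (ℓ 2 + 1)) := by
  refine h.isAdjMatrixOf_of_spider hs hsurj ?_ (fun _ => 2) (fun a => a - 1) ?_ ?_ ?_ ?_ ?_
  · simp only [typeL]
    rw [Multiset.singleton_add, Multiset.nodup_cons, mk_mem_path]
    exact ⟨by omega, nodup_path _ _⟩
  · intro a h1 h2
    simp only [typeL] at h2
    show a - 1 ≤ ℓ 2
    omega
  · intro a b h1 h2 h3 h4 h5 _
    omega
  · intro x k hk
    simp only [typeL]
    refine ⟨k + 1, by omega, ?_, by omega, ?_⟩ <;> fin_cases x <;> simp at hk ⊢ <;> omega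
  · intro a b h1 h2 h3 h4 hab
    simp only [typeL] at h2 h4
    simp only [typeL, Multiset.mem_add, Multiset.mem_singleton, mk_mem_path, SpiderAdj,
      Sym2.eq_iff, eq_self, true_or, true_and]
    omega
  · intro a h1 h2
    simp only [typeL] at h2
    simp only [typeL, Multiset.mem_add, Multiset.mem_singleton, mk_mem_path, Sym2.eq_iff]
    constructor
    · intro ha
      obtain rfl : a = 1 := by omega
      rw [Nat.sub_self, hs.root]
      exact hc
    · intro ha
      have heq := h.loop_unique ha hc
      rw [← hs.root 2] at heq
      have := (hs.isPath_arm 2).1 _ _ (by omega) (Nat.zero_le _) heq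
      omega

lemma isAdjMatrixOf_typeD (hloop : ∀ v, X v v = 0) (h0 : ℓ 0 = 1) (h1 : ℓ 1 = 1) :
    IsAdjMatrixOf X (typeD (ℓ 2 + 3)) := by
  refine h.isAdjMatrixOf_of_spider hs hsurj ?_
    (fun a => if a = 1 then 0 else if a = 2 then 1 else 2)
    (fun a => if a ≤ 2 then 1 else a - 3) ?_ ?_ ?_ ?_ ?_
  · simp only [typeD]
    rw [Multiset.insert_eq_cons, Multiset.cons_add, Multiset.singleton_add, Multiset.nodup_cons,
      Multiset.nodup_cons, Multiset.mem_cons, mk_mem_path, mk_mem_path]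
    refine ⟨?_, by omega, nodup_path _ _⟩
    rw [Sym2.eq_iff]
    omega
  · intro a h1 h2
    simp only [typeD] at h2
    split_ifs <;> omega
  · intro a b h1 h2 h3 h4 h5 h6
    simp only [typeD] at h2 h4
    split_ifs at h5 h6 <;> simp at h6 <;> omega
  · intro x k hk
    simp only [typeD]
    by_cases hk0 : k = 0
    · exact ⟨3, by omega, by omega, by simp [hk0]⟩
    · fin_cases x
      · have hk' : k ≤ ℓ 0 := hk
        exact ⟨1, by omega, by omega, by simp; omega⟩
      · have hk' : k ≤ ℓ 1 := hk
        exact ⟨2, by omega, by omega, by simp; omega⟩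
      · have hk' : k ≤ ℓ 2 := hk
        exact ⟨k + 3, by omega, by omega, by simp⟩
  · intro a b h1 h2 h3 h4 hab
    simp only [typeD] at h2 h4
    simp only [typeD, Multiset.mem_add, Multiset.insert_eq_cons, Multiset.mem_cons,
      Multiset.mem_singleton, mk_mem_path, SpiderAdj, Sym2.eq_iff]
    rcases (by omega : a = 1 ∨ a = 2 ∨ 3 ≤ a) with rfl | rfl | ha <;>
    rcases (by omega : b = 1 ∨ b = 2 ∨ 3 ≤ b) with rfl | rfl | hb <;>
    · simp (disch := omega) only [if_neg, if_pos, ite_true]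
      simp
      try omega
  · intro a h1 h2
    simp only [hloop, typeD, Multiset.mem_add, Multiset.insert_eq_cons, Multiset.mem_cons,
      Multiset.mem_singleton, mk_mem_path, Sym2.eq_iff]
    omega

lemma isAdjMatrixOf_typeE (hloop : ∀ v, X v v = 0) (h0 : ℓ 0 = 1) (h1 : ℓ 1 = 2)
    (h2 : 2 ≤ ℓ 2) : IsAdjMatrixOf X (typeE (ℓ 2 + 4)) := by
  refine h.isAdjMatrixOf_of_spider hs hsurj ?_
    (fun a => if a ≤ 2 then 1 else if a = ℓ 2 + 4 then 0 else 2)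
    (fun a => if a ≤ 2 then 3 - a else if a = ℓ 2 + 4 then 1 else a - 3) ?_ ?_ ?_ ?_ ?_
  · simp only [typeE]
    rw [add_comm, Multiset.singleton_add, Multiset.nodup_cons, mk_mem_path]
    exact ⟨by omega, nodup_path _ _⟩
  · intro a h1 h2
    simp only [typeE] at h2
    split_ifs <;> omega
  · intro a b h1 h2 h3 h4 h5 h6
    simp only [typeE] at h2 h4
    split_ifs at h5 h6 <;> simp at h6 <;> omega
  · intro x k hk
    simp only [typeE]
    by_cases hk0 : k = 0
    · exact ⟨3, by omega, by omega, by simp [hk0]⟩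
    · fin_cases x
      · have hk' : k ≤ ℓ 0 := hk
        exact ⟨ℓ 2 + 4, by omega, by omega, by simp; omega⟩
      · have hk' : k ≤ ℓ 1 := hk
        refine ⟨3 - k, by omega, by omega, ?_⟩
        rw [if_pos (by omega), if_pos (by omega)]
        exact ⟨by omega, Or.inl rfl⟩
      · have hk' : k ≤ ℓ 2 := hk
        refine ⟨k + 3, by omega, by omega, ?_⟩
        rw [if_neg (by omega), if_neg (by omega), if_neg (by omega), if_neg (by omega)]
        exact ⟨by omega, Or.inl rfl⟩
  · intro a b h1 h2 h3 h4 hab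
    simp only [typeE] at h2 h4
    simp only [typeE, Multiset.mem_add, Multiset.mem_singleton, mk_mem_path, SpiderAdj,
      Sym2.eq_iff]
    rcases (by omega : a ≤ 2 ∨ a = ℓ 2 + 4 ∨ (3 ≤ a ∧ a ≤ ℓ 2 + 3)) with ha | rfl | ha <;>
    rcases (by omega : b ≤ 2 ∨ b = ℓ 2 + 4 ∨ (3 ≤ b ∧ b ≤ ℓ 2 + 3)) with hb | rfl | hb <;>
    · simp (disch := omega) only [if_neg, if_pos, ite_true]
      simp
      try omega
  · intro a h1 h2
    simp only [hloop, typeE, Multiset.mem_add, Multiset.mem_singleton, mk_mem_path, Sym2.eq_iff]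
    omega

end Identification

/-- `Ẽ₆` is excluded. -/
lemma not_two_two_two (h : IsFiniteType X) (hs : IsSpider X c ℓ ψ) (h0 : 2 ≤ ℓ 0) (h1 : 2 ≤ ℓ 1)
    (h2 : 2 ≤ ℓ 2) : False := by
  let α : ℕ → Fin 3 := fun a => [1, 1, 2, 2, 2, 0, 0].getD (a - 1) 0
  let κ : ℕ → ℕ := fun a => [2, 1, 0, 1, 2, 1, 2].getD (a - 1) 0
  refine h.no_embedding_spider hs (G := typeTildeE6) (by unfold IsTypeTilde; tauto) (by decide)
    α κ ?_ ?_ ?_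
  · intro a h1 h2
    change a ≤ 7 at h2
    interval_cases a <;> simp [α, κ] <;> omega
  · intro a b h1 h2 h3 h4
    change a ≤ 7 at h2
    change b ≤ 7 at h4
    interval_cases a <;> interval_cases b <;> decide
  · intro a b h1 h2 h3 h4
    change a ≤ 7 at h2
    change b ≤ 7 at h4
    interval_cases a <;> interval_cases b <;> decide

/-- `Ẽ₇` is excluded. -/
lemma not_one_three_three (h : IsFiniteType X) (hs : IsSpider X c ℓ ψ) (h0 : 1 ≤ ℓ 0)
    (h1 : 3 ≤ ℓ 1) (h2 : 3 ≤ ℓ 2) : False := by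
  let α : ℕ → Fin 3 := fun a => [1, 1, 2, 2, 2, 2, 0, 1].getD (a - 1) 0
  let κ : ℕ → ℕ := fun a => [2, 1, 0, 1, 2, 3, 1, 3].getD (a - 1) 0
  refine h.no_embedding_spider hs (G := typeTildeE7) (by unfold IsTypeTilde; tauto) (by decide)
    α κ ?_ ?_ ?_
  · intro a h1 h2
    change a ≤ 8 at h2
    interval_cases a <;> simp [α, κ] <;> omega
  · intro a b h1 h2 h3 h4
    change a ≤ 8 at h2
    change b ≤ 8 at h4
    interval_cases a <;> interval_cases b <;> decide
  · intro a b h1 h2 h3 h4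
    change a ≤ 8 at h2
    change b ≤ 8 at h4
    interval_cases a <;> interval_cases b <;> decide

/-- `Ẽ₈` is excluded. -/
lemma not_one_two_five (h : IsFiniteType X) (hs : IsSpider X c ℓ ψ) (h0 : 1 ≤ ℓ 0)
    (h1 : 2 ≤ ℓ 1) (h2 : 5 ≤ ℓ 2) : False := by
  let α : ℕ → Fin 3 := fun a => [1, 1, 2, 2, 2, 2, 2, 0, 2].getD (a - 1) 0
  let κ : ℕ → ℕ := fun a => [2, 1, 0, 1, 2, 3, 4, 1, 5].getD (a - 1) 0
  refine h.no_embedding_spider hs (G := typeTildeE8) (by unfold IsTypeTilde; tauto) (by decide)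
    α κ ?_ ?_ ?_
  · intro a h1 h2
    change a ≤ 9 at h2
    interval_cases a <;> simp [α, κ] <;> omega
  · intro a b h1 h2 h3 h4
    change a ≤ 9 at h2
    change b ≤ 9 at h4
    interval_cases a <;> interval_cases b <;> decide
  · intro a b h1 h2 h3 h4
    change a ≤ 9 at h2
    change b ≤ 9 at h4
    interval_cases a <;> interval_cases b <;> decide

/-- The centre of the spider is the vertex with a loop, or else the branch vertex, or else any
vertex. -/
theorem exists_isTypeADEL (h : IsFiniteType X) : ∃ G, IsTypeADEL G ∧ IsAdjMatrixOf X G := by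
  -- The arms are numbered by increasing length.
  have hsorted : ∀ c, (∀ v, IsBranch X v → v = c) → ∃ ℓ ψ, IsSpider X c ℓ ψ ∧
      (∀ v, ∃ a, ∃ k ≤ ℓ a, ψ a k = v) ∧ ℓ 0 ≤ ℓ 1 ∧ ℓ 1 ≤ ℓ 2 := by
    intro c hc
    obtain ⟨ℓ, ψ, hs, hsurj⟩ := h.exists_spanning_spider hc
    have hmono := Tuple.monotone_sort ℓ
    refine ⟨_, _, hs.perm (Tuple.sort ℓ), fun v => ?_, hmono (by decide), hmono (by decide)⟩
    obtain ⟨a, k, hk, rfl⟩ := hsurj v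
    exact ⟨(Tuple.sort ℓ).symm a, k, by simpa using hk, by simp⟩
  by_cases hl : ∃ c, X c c ≠ 0
  · obtain ⟨c, hc⟩ := hl
    obtain ⟨ℓ, ψ, hs, hsurj, h01, h12⟩ :=
      hsorted c fun v hv => absurd hv (h.not_isBranch_of_loop hc v)
    have h1 : ℓ 1 = 0 := by
      by_contra h1
      have hadj : ∀ a, 1 ≤ ℓ a → Adj X c (ψ a 1) := fun a ha => by
        have := hs.adj a 0 ha
        rwa [hs.root] at this
      have heq := h.neighbor_unique_of_loop hc (hadj 1 (by omega)) (hadj 2 (by omega))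
      rcases (hs.inj 1 2 1 1 (by omega) (by omega) heq).2 with h3 | h3
      · exact absurd h3 (by decide)
      · omega
    exact ⟨_, Or.inr (Or.inr (Or.inr ⟨ℓ 2 + 1, by omega, rfl⟩)),
      h.isAdjMatrixOf_typeL hs hsurj hc (by omega) h1⟩
  · push Not at hl
    obtain ⟨c, hc⟩ : ∃ c, ∀ v, IsBranch X v → v = c := by
      by_cases hb : ∃ c, IsBranch X c
      · obtain ⟨c, hc⟩ := hb
        exact ⟨c, fun v hv => h.branch_unique hv hc⟩
      · obtain ⟨c⟩ := h.ind.1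
        exact ⟨c, fun v hv => absurd ⟨v, hv⟩ hb⟩
    obtain ⟨ℓ, ψ, hs, hsurj, h01, h12⟩ := hsorted c hc
    rcases Nat.eq_zero_or_pos (ℓ 0) with h0 | h0
    · exact ⟨_, Or.inl ⟨ℓ 1 + ℓ 2 + 1, by omega, rfl⟩, h.isAdjMatrixOf_typeA hs hsurj hl h0⟩
    have h0' : ℓ 0 = 1 := by
      by_contra hne
      exact h.not_two_two_two hs (by omega) (by omega) (by omega)
    rcases (by omega : ℓ 1 = 1 ∨ ℓ 1 = 2 ∨ 3 ≤ ℓ 1) with h1 | h1 | h1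
    · exact ⟨_, Or.inr (Or.inl ⟨ℓ 2 + 3, by omega, rfl⟩),
        h.isAdjMatrixOf_typeD hs hsurj hl h0' h1⟩
    · have h2 : ℓ 2 < 5 := by
        by_contra h2
        exact h.not_one_two_five hs (by omega) (by omega) (by omega)
      refine ⟨typeE (ℓ 2 + 4), Or.inr (Or.inr (Or.inl ?_)),
        h.isAdjMatrixOf_typeE hs hsurj hl h0' h1 (by omega)⟩
      rcases (by omega : ℓ 2 = 2 ∨ ℓ 2 = 3 ∨ ℓ 2 = 4) with h3 | h3 | h3 <;> simp [h3]
    · exact (h.not_one_three_three hs (by omega) h1 (by omega)).elim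

end IsFiniteType

end ChebyshevDynkin

theorem mainTheorem3 {ι : Type*} [Fintype ι] [DecidableEq ι] (X : Matrix ι ι ℤ)
    (hsymm : X.IsSymm) (hnonneg : ∀ i j, 0 ≤ X i j)
    (hind : ChebyshevDynkin.IsIndecomposable X) :
    ((∃ d : ℕ, 1 ≤ d ∧ ChebyshevDynkin.f d X = 0) ↔
      ∃ G : ChebyshevDynkin.Diagram,
        ChebyshevDynkin.IsTypeADEL G ∧ ChebyshevDynkin.IsAdjMatrixOf X G) ∧
    (ChebyshevDynkin.GrowsLinearly (fun k => ChebyshevDynkin.f k X) ↔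
      ∃ G : ChebyshevDynkin.Diagram,
        ChebyshevDynkin.IsTypeTilde G ∧ ChebyshevDynkin.IsAdjMatrixOf X G) := by
  have : Nonempty ι := hind.1
  refine ⟨⟨?_, ?_⟩, ?_, ?_⟩
  · rintro ⟨d, -, hd⟩
    refine ChebyshevDynkin.IsFiniteType.exists_isTypeADEL
      ⟨hsymm, hnonneg, hind, ChebyshevDynkin.form_le_of_f_eq_zero hsymm hd, fun G hG hXG => ?_⟩
    obtain ⟨δ, hδ, hδX⟩ := ChebyshevDynkin.exists_harmonic_of_isTypeTilde hG hXG
    exact ChebyshevDynkin.f_ne_zero_of_harmonic hδ hδX d hd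
  · rintro ⟨G, hG, hXG⟩
    exact ChebyshevDynkin.exists_f_eq_zero_of_bounded
      (ChebyshevDynkin.bounded_of_isTypeADEL hsymm hnonneg hind hG hXG)
  · intro hlin
    by_contra hno
    obtain ⟨G, hG, hXG⟩ := ChebyshevDynkin.IsFiniteType.exists_isTypeADEL ⟨hsymm, hnonneg, hind,
      ChebyshevDynkin.form_le_of_growsLinearly hsymm hlin, fun G hG hXG => hno ⟨G, hG, hXG⟩⟩
    exact ChebyshevDynkin.not_growsLinearly_of_bounded
      (ChebyshevDynkin.bounded_of_isTypeADEL hsymm hnonneg hind hG hXG) hlin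
  · rintro ⟨G, hG, hXG⟩
    obtain ⟨δ, hδ, hδX⟩ := ChebyshevDynkin.exists_harmonic_of_isTypeTilde hG hXG
    exact ChebyshevDynkin.growsLinearly_of_harmonic hsymm hnonneg hδ hδX
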